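/- Let $X$ be a real random variable on a probability space, with law $\mu_X$, whose moment generating function is finite near zero: there is $t_0>0$ with $\mathbb E\,e^{tX}<\infty$ for all $t\in(-t_0,t_0)$. Let $m=\mathbb E[X]$ and let $q(x)=\delta x^2+\beta x+\gamma$ with $\delta,\beta,\gamma\in\mathbb R$ (polynomial of degree at most two). (a) (Continuous Pearson case.) Suppose $X$ has a density $f\ge 0$ with $$\int_{-\infty}^x (m-t)f(t)\,dt=q(x)f(x)\qquad\text{for all }x\in\mathbb R .$$ Let $(r,s)$ be the open support interval of $X$, i.e. the interior of $\{x: f(x)>0\}$. Let $g_1,g_2\in L^2(\mathbb R,\mu_X)$ be infinitely differentiable on $(r,s)$ with $$\mathbb E\bigl[q^k(X)\,|g_i^{(k)}(X)|\bigr]<\infty,\qquad k=0,1,2,\ldots,\ i=1,2 .$$ Then $$\operatorname{Cov}[g_1(X),g_2(X)]=\sum_{k=1}^\infty \frac{\mathbb E[q^k(X)g_1^{(k)}(X)]\;\mathbb E[q^k(X)g_2^{(k)}(X)]}{k!\;\mathbb E[q^k(X)]\;\prod_{j=k-1}^{2k-2}(1-j\delta)},$$ where the series converges (absolutely). (b)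 (Discrete Pearson, or Ord, case.) Suppose $X$ takes values in $\{0,1,2,\ldots\}$ and its probability function $p(x)=\Pr(X=x)$ satisfies $$\sum_{j=0}^x (m-j)p(j)=q(x)p(x),\qquad x=0,1,2,\ldots .$$ Write $\Delta g(x)=g(x+1)-g(x)$, $\Delta^k=\Delta\circ\Delta^{k-1}$, $\Delta^0 g=g$, and $q^{[k]}(x)=q(x)q(x+1)\cdots q(x+k-1)$, $q^{[0]}=1$. Let $g_1,g_2:\{0,1,2,\ldots\}\to\mathbb R$ satisfy $\mathbb E[g_i(X)^2]<\infty$ and $$\mathbb E\bigl[q^{[k]}(X)\,|\Delta^k g_i(X)|\bigr]<\infty,\qquad k=0,1,2,\ldots,\ i=1,2 .$$ Then $$\operatorname{Cov}[g_1(X),g_2(X)]=\sum_{k=1}^\infty \frac{\mathbb E[q^{[k]}(X)\Delta^k g_1(X)]\;\mathbb E[q^{[k]}(X)\Delta^k g_2(X)]}{k!\;\mathbb E[q^{[k]}(X)]\;\prod_{j=k-1}^{2k-2}(1-j\delta)},$$ where each term with $\mathbb E[q^{[k]}(X)]=0$ is read as zero and the series converges (absolutely). -/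

import Mathlib

open MeasureTheory ProbabilityTheory

namespace Pearson

/-- The quadratic `q(x) = δ x² + β x + γ` (of degree at most two). -/
def quad (δ β γ x : ℝ) : ℝ := δ * x ^ 2 + β * x + γ

/-- The ascending product `q^{[k]}(x) = q(x) q(x+1) ⋯ q(x+k-1)`, with `q^{[0]} = 1`. -/
def ascQuad (δ β γ : ℝ) (k : ℕ) (x : ℝ) : ℝ :=
  ∏ i ∈ Finset.range k, quad δ β γ (x + i)

/-- `Y` has a finite moment generating function in a neighbourhood of zero. -/
def FiniteMGFNearZero {Ω : Type*} [MeasurableSpace Ω] (Y : Ω → ℝ) (P : Measure Ω) : Prop :=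
  ∃ t₀ : ℝ, 0 < t₀ ∧ ∀ t ∈ Set.Ioo (-t₀) t₀, Integrable (fun ω => Real.exp (t * Y ω)) P

/-- The real random variable `X` has density `f` and finite mean `m`, and
`∫_{-∞}^x (m - t) f(t) dt = q(x) f(x)` for every real `x`, where `q(x) = δ x² + β x + γ`. -/
structure IsContinuous {Ω : Type*} [MeasurableSpace Ω] (P : Measure Ω)
    (X : Ω → ℝ) (f : ℝ → ℝ) (δ β γ : ℝ) : Prop where
  aemeasurable : AEMeasurable X P
  integrable : Integrable X P
  measurable_density : Measurable f
  density_nonneg : ∀ x, 0 ≤ f x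
  law : P.map X = volume.withDensity (fun x => ENNReal.ofReal (f x))
  identity : ∀ x : ℝ, ∫ t in Set.Iic x, ((∫ ω, X ω ∂P) - t) * f t = quad δ β γ x * f x

/-- The open support interval `(r, s)` of the density. Under the Pearson identity the set
`{f > 0}` is an open interval up to points at which `q` vanishes, where the identity leaves the
value of `f` free; taking the interior discards these. -/
def openSupport (f : ℝ → ℝ) : Set ℝ := interior {x | 0 < f x}

/-- The random variable `X` with values in `{0, 1, 2, …}` has finite mean `m`, and its probability
function `p` satisfies `∑_{j=0}^x (m - j) p(j) = q(x) p(x)` for `x = 0, 1, 2, …`, where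
`q(x) = δ x² + β x + γ`. -/
structure IsDiscrete {Ω : Type*} [MeasurableSpace Ω] (P : Measure Ω)
    (X : Ω → ℕ) (δ β γ : ℝ) : Prop where
  aemeasurable : AEMeasurable X P
  integrable : Integrable (fun ω => (X ω : ℝ)) P
  identity : ∀ x : ℕ,
    ∑ j ∈ Finset.range (x + 1), ((∫ ω, (X ω : ℝ) ∂P) - j) * P.real {ω | X ω = j} =
      quad δ β γ x * P.real {ω | X ω = x}

end Pearson

namespace Pearson

/-! Both cases rest on one first-order identity, E[(X-m)h(X)] = E[q(X)h'(X)], with Δ replacing the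
derivative in the discrete case. It is Fubini for a nonnegative kernel, since the Pearson identity
says that E[(m-X)1_{X≤t}] is q times the density or mass at t (`stein_identity`).

Put G_j = q^j g^(j), or q^[j] Δ^j g. The identity for h = u G_j, with u a polynomial, takes one
derivative off g: E[v G_{j+1}] = E[(A_j v) G_j] for an explicit operator A_j on polynomials.
Iterating, E[G_k] = E[P_k g] with P_k = A_0 ⋯ A_{k-1} 1 (`IsSteinChain.integral_rodrigues`). For
polynomial g of degree at most k, G_k is a constant times q^k or q^[k]. Hence P_k is orthogonal to
lower degrees, and E[P_k²] is k! E[q^k] (or k! E[q^[k]]) times the coefficient of x^k in P_k, which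
is ∏_{j=k-1}^{2k-2}(1-jδ). The series is therefore Parseval's identity without its k = 0 term
E[g₁]E[g₂] (`IsRodriguesSystem.hasSum_cov`). Completeness holds because a moment generating function
finite near zero makes polynomials dense in L².

Two points need care. Integrability of u G_j is assumed only for u = 1: if δ = 0 it spreads to all u
by induction on the degree, otherwise the support turns out to be bounded. And E[q^[k]] may vanish
in the discrete case; then the support has at most k points, and a monic polynomial of degree k
vanishing there replaces P_k in the completeness argument. -/

open Polynomial Filter Topology

/-! ### Moment determinacy and completeness of polynomials in L² -/

/-- Two finite measures on the line with the same moments agree if their moment generating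
functions are finite near zero. -/
theorem ext_of_moments {μ ν : Measure ℝ} [IsFiniteMeasure μ] [IsFiniteMeasure ν]
    (hμ : 0 ∈ interior (integrableExpSet id μ)) (hν : 0 ∈ interior (integrableExpSet id ν))
    (h : ∀ n : ℕ, ∫ x, x ^ n ∂μ = ∫ x, x ^ n ∂ν) : μ = ν := by
  have aμ : AnalyticAt ℂ (complexMGF id μ) 0 := analyticAt_complexMGF (by simpa using hμ)
  have aν : AnalyticAt ℂ (complexMGF id ν) 0 := analyticAt_complexMGF (by simpa using hν)
  have hd : ∀ n, iteratedDeriv n (complexMGF id μ) 0 = iteratedDeriv n (complexMGF id ν) 0 := by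
    intro n
    rw [iteratedDeriv_complexMGF (by simpa using hμ), iteratedDeriv_complexMGF (by simpa using hν)]
    simp only [id, zero_mul, Complex.exp_zero, mul_one]
    have := congrArg (fun r : ℝ => (r : ℂ)) (h n)
    simp only [← integral_complex_ofReal] at this
    simpa using this
  have hev : complexMGF id μ =ᶠ[𝓝 0] complexMGF id ν := by
    have h1 := aμ.hasFPowerSeriesAt
    have h2 := aν.hasFPowerSeriesAt
    simp only [hd] at h1
    have h3 := h1.sub h2
    rw [sub_self] at h3
    filter_upwards [h3.eventually_eq_zero] with z hz
    exact sub_eq_zero.1 hz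
  -- An intersection of two vertical strips: convex, and containing both 0 and the imaginary axis,
  -- where the transform is the characteristic function.
  let U : Set ℂ := {z | z.re ∈ interior (integrableExpSet id μ)} ∩
    {z | z.re ∈ interior (integrableExpSet id ν)}
  have hU : IsPreconnected U :=
    ((convex_integrableExpSet.interior.linear_preimage Complex.reLm).inter
      (convex_integrableExpSet.interior.linear_preimage Complex.reLm)).isPreconnected
  have hEq : Set.EqOn (complexMGF id μ) (complexMGF id ν) U :=
    AnalyticOnNhd.eqOn_of_preconnected_of_eventuallyEq
      (analyticOnNhd_complexMGF.mono Set.inter_subset_left)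
      (analyticOnNhd_complexMGF.mono Set.inter_subset_right) hU
      (z₀ := 0) ⟨by simpa using hμ, by simpa using hν⟩ hev
  refine Measure.ext_of_charFun (funext fun t => ?_)
  rw [← complexMGF_id_mul_I, ← complexMGF_id_mul_I]
  exact hEq ⟨by simpa using hμ, by simpa using hν⟩

theorem integrable_mul_of_memLp_two {Ω : Type*} [MeasurableSpace Ω] {P : Measure Ω} {f g : Ω → ℝ}
    (hf : MemLp f 2 P) (hg : MemLp g 2 P) : Integrable (fun x => f x * g x) P :=
  hf.integrable_mul hg

theorem zero_mem_interior_integrableExpSet {Ω : Type*} [MeasurableSpace Ω] {P : Measure Ω}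
    {Y : Ω → ℝ} (h : FiniteMGFNearZero Y P) : 0 ∈ interior (integrableExpSet Y P) := by
  obtain ⟨t, ht, hI⟩ := h
  refine mem_interior.2 ⟨Set.Ioo (-t) t, fun s hs => hI s hs, isOpen_Ioo, by simpa using ht⟩

theorem memLp_exp_mul {μ : Measure ℝ} {t₀ : ℝ}
    (hI : ∀ t ∈ Set.Ioo (-t₀) t₀, Integrable (fun x : ℝ => Real.exp (t * x)) μ)
    {t : ℝ} (ht : t ∈ Set.Ioo (-(t₀ / 2)) (t₀ / 2)) :
    MemLp (fun x : ℝ => Real.exp (t * x)) 2 μ := by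
  rw [memLp_two_iff_integrable_sq (by fun_prop)]
  refine (hI (2 * t) ⟨by linarith [ht.1], by linarith [ht.2]⟩).congr (ae_of_all _ fun x => ?_)
  simp only [← Real.exp_nat_mul]
  congr 1; push_cast; ring

theorem memLp_pow {μ : Measure ℝ} [IsFiniteMeasure μ]
    (h : 0 ∈ interior (integrableExpSet id μ)) (n : ℕ) : MemLp (fun x : ℝ => x ^ n) 2 μ := by
  rw [memLp_two_iff_integrable_sq (by fun_prop)]
  have := integrable_pow_of_mem_interior_integrableExpSet h (2 * n)
  refine this.congr (ae_of_all _ fun x => ?_)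
  simp [pow_mul, mul_comm 2 n]

theorem memLp_eval {μ : Measure ℝ} [IsFiniteMeasure μ]
    (h : 0 ∈ interior (integrableExpSet id μ)) (p : ℝ[X]) : MemLp (fun x => p.eval x) 2 μ := by
  simp only [eval_eq_sum_range]
  exact memLp_finsetSum _ fun i _ => (memLp_pow h i).const_mul _

/-- A square-integrable function orthogonal to all monomials vanishes. -/
theorem ae_eq_zero_of_forall_integral_pow_mul {μ : Measure ℝ} [IsProbabilityMeasure μ]
    (hμ : FiniteMGFNearZero id μ) {h : ℝ → ℝ} (hh : MemLp h 2 μ)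
    (h0 : ∀ n : ℕ, ∫ x, x ^ n * h x ∂μ = 0) : h =ᵐ[μ] 0 := by
  have hInt := zero_mem_interior_integrableExpSet hμ
  obtain ⟨t₀, ht₀, hI⟩ := hμ
  have key : ∀ g : ℝ → ℝ, MemLp g 2 μ →
      IsFiniteMeasure (μ.withDensity fun x => ENNReal.ofReal (g x)) ∧
      0 ∈ interior (integrableExpSet id (μ.withDensity fun x => ENNReal.ofReal (g x))) ∧
      ∀ n : ℕ, ∫ x, x ^ n ∂(μ.withDensity fun x => ENNReal.ofReal (g x)) =
        ∫ x, x ^ n * max (g x) 0 ∂μ := by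
    intro g hg
    have hm : AEMeasurable (fun x => ENNReal.ofReal (g x)) μ :=
      hg.1.aemeasurable.ennreal_ofReal
    refine ⟨isFiniteMeasure_withDensity_ofReal (hg.integrable (by norm_num)).2, ?_, fun n => ?_⟩
    · refine mem_interior.2 ⟨Set.Ioo (-(t₀ / 2)) (t₀ / 2), fun t ht => ?_, isOpen_Ioo,
        by simpa using ht₀⟩
      -- Cauchy–Schwarz: e^{tx} is in L² only for |t| < t₀/2, since its square is e^{2tx}.
      have h1 := integrable_mul_of_memLp_two hg.pos_part (memLp_exp_mul hI ht)
      simp only [integrableExpSet, Set.mem_ofPred_eq, id]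
      rw [integrable_withDensity_iff_integrable_smul₀' hm (ae_of_all _ fun _ => ENNReal.ofReal_lt_top)]
      simpa [ENNReal.toReal_ofReal'] using h1
    · rw [integral_withDensity_eq_integral_toReal_smul₀ hm (ae_of_all _ fun _ => ENNReal.ofReal_lt_top)]
      simp [ENNReal.toReal_ofReal', mul_comm]
  obtain ⟨f1, i1, m1⟩ := key h hh
  have hn : MemLp (fun x => - h x) 2 μ := hh.neg
  obtain ⟨f2, i2, m2⟩ := key (fun x => - h x) hn
  -- The positive and negative parts of h, as densities, have equal moments, so they agree; as one
  -- of them is zero at each point, both vanish.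
  have heq := ext_of_moments i1 i2 fun n => by
    rw [m1, m2, ← sub_eq_zero, ← integral_sub
      (integrable_mul_of_memLp_two (memLp_pow hInt n) hh.pos_part)
      (integrable_mul_of_memLp_two (memLp_pow hInt n) hn.pos_part)]
    refine (integral_congr_ae (ae_of_all _ fun x => ?_)).trans (h0 n)
    rcases le_total (h x) 0 with hx | hx <;> simp [hx]
  rw [withDensity_eq_iff hh.1.aemeasurable.ennreal_ofReal hn.1.aemeasurable.ennreal_ofReal] at heq
  · filter_upwards [heq] with x hx
    have := congrArg ENNReal.toReal hx
    simp only [ENNReal.toReal_ofReal'] at this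
    rcases le_total (h x) 0 with hx | hx <;> simp_all
  · have := (measure_ne_top (μ.withDensity fun x => ENNReal.ofReal (h x)) Set.univ)
    simpa [withDensity_apply] using this

/-! ### Rodrigues polynomials: leading coefficients, orthogonality, Parseval -/

/-- Apply `A (k - 1)`, …, `A 1`, `A 0` successively. -/
noncomputable def rodrigues (A : ℕ → ℝ[X] → ℝ[X]) : ℕ → ℝ[X] → ℝ[X]
  | 0, v => v
  | k + 1, v => rodrigues A k (A k v)

/-- The operators `A j` raise degrees by at most one, with the effect on leading coefficients
that is common to the continuous and the discrete Pearson family. -/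
def IsRaising (A : ℕ → ℝ[X] → ℝ[X]) (δ : ℝ) : Prop :=
  ∀ (j d : ℕ) (v : ℝ[X]), v.natDegree ≤ d →
    (A j v).natDegree ≤ d + 1 ∧ (A j v).coeff (d + 1) = (1 - (2 * j + d) * δ) * v.coeff d

/-- `A j` acts when the degree bound has grown to d + k - 1 - j, and 2j + (d + k - 1 - j) = j + d +
k - 1. -/
theorem IsRaising.rodrigues {A : ℕ → ℝ[X] → ℝ[X]} {δ : ℝ} (hA : IsRaising A δ) (k : ℕ) :
    ∀ (d : ℕ) (v : ℝ[X]), v.natDegree ≤ d → (rodrigues A k v).natDegree ≤ d + k ∧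
      (rodrigues A k v).coeff (d + k) =
        (∏ j ∈ Finset.range k, (1 - ((j : ℝ) + d + k - 1) * δ)) * v.coeff d := by
  induction k with
  | zero => intro d v hv; simpa [Pearson.rodrigues] using hv
  | succ k ih =>
    intro d v hv
    obtain ⟨h1, h2⟩ := hA k d v hv
    obtain ⟨h3, h4⟩ := ih (d + 1) _ h1
    rw [show d + (k + 1) = d + 1 + k by ring]
    refine ⟨h3, ?_⟩
    rw [Pearson.rodrigues, h4, h2, Finset.prod_range_succ, mul_assoc]
    congr 1
    · refine Finset.prod_congr rfl fun j _ => ?_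
      push_cast; ring
    · push_cast; ring

/-- A system of Rodrigues polynomials adapted to a probability measure on the line. -/
structure IsRodriguesSystem (μ : Measure ℝ) (A : ℕ → ℝ[X] → ℝ[X]) (δ : ℝ) (e : ℕ → ℝ) : Prop where
  mgf : FiniteMGFNearZero id μ
  raising : IsRaising A δ
  nonneg : ∀ k, 0 ≤ e k
  integral : ∀ (k : ℕ) (u : ℝ[X]), u.natDegree ≤ k →
    ∫ x, (rodrigues A k 1).eval x * u.eval x ∂μ = k.factorial * u.coeff k * e k

/-- The leading coefficient of the `k`-th Rodrigues polynomial. -/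
noncomputable def lead (δ : ℝ) (k : ℕ) : ℝ := ∏ j ∈ Finset.range k, (1 - ((j : ℝ) + k - 1) * δ)

theorem lead_succ (δ : ℝ) (n : ℕ) :
    lead δ (n + 1) = ∏ j ∈ Finset.Icc n (2 * n), (1 - (j : ℝ) * δ) := by
  rw [lead, show Finset.Icc n (2 * n) = Finset.Ico n (2 * n + 1) by ext; simp,
    Finset.prod_Ico_eq_prod_range, show 2 * n + 1 - n = n + 1 by omega]
  refine Finset.prod_congr rfl fun j _ => ?_
  push_cast; ring

namespace IsRodriguesSystem

variable {μ : Measure ℝ} {A : ℕ → ℝ[X] → ℝ[X]} {δ : ℝ} {e : ℕ → ℝ}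

theorem natDegree_le (h : IsRodriguesSystem μ A δ e) (k : ℕ) :
    (rodrigues A k 1).natDegree ≤ k := by
  simpa using (h.raising.rodrigues k 0 1 (by simp)).1

theorem coeff_eq (h : IsRodriguesSystem μ A δ e) (k : ℕ) :
    (rodrigues A k 1).coeff k = lead δ k := by
  simpa [lead] using (h.raising.rodrigues k 0 1 (by simp)).2

theorem integral_sq (h : IsRodriguesSystem μ A δ e) (k : ℕ) :
    ∫ x, (rodrigues A k 1).eval x * (rodrigues A k 1).eval x ∂μ =
      k.factorial * e k * lead δ k := by
  rw [h.integral k _ (h.natDegree_le k), h.coeff_eq]; ring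

theorem integral_eq_zero (h : IsRodriguesSystem μ A δ e) {k l : ℕ} (hkl : k ≠ l) :
    ∫ x, (rodrigues A k 1).eval x * (rodrigues A l 1).eval x ∂μ = 0 := by
  have key : ∀ k l : ℕ, l < k →
      ∫ x, (rodrigues A k 1).eval x * (rodrigues A l 1).eval x ∂μ = 0 := by
    intro k l hlk
    rw [h.integral k _ ((h.natDegree_le l).trans hlk.le),
      coeff_eq_zero_of_natDegree_lt ((h.natDegree_le l).trans_lt hlk)]
    simp
  rcases lt_or_gt_of_ne hkl with hlt | hlt
  · simpa only [mul_comm] using key l k hlt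
  · exact key k l hlt

variable [IsProbabilityMeasure μ]

theorem memLp (h : IsRodriguesSystem μ A δ e) (p : ℝ[X]) : MemLp (fun x => p.eval x) 2 μ :=
  memLp_eval (zero_mem_interior_integrableExpSet h.mgf) p

/-- Otherwise the squared norm k! e_k `lead δ k` is at most 0, so P_k vanishes almost everywhere;
but its pairing with x^k is k! e_k > 0. -/
theorem lead_pos (h : IsRodriguesSystem μ A δ e) {k : ℕ} (he : 0 < e k) : 0 < lead δ k := by
  by_contra! hle
  have hsq := h.integral_sq k
  have h0 : ∫ x, (rodrigues A k 1).eval x * (rodrigues A k 1).eval x ∂μ = 0 := by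
    refine le_antisymm ?_ (integral_nonneg fun x => mul_self_nonneg _)
    rw [hsq]
    exact mul_nonpos_of_nonneg_of_nonpos (by positivity) hle
  rw [integral_eq_zero_iff_of_nonneg (fun x => mul_self_nonneg _)
    (integrable_mul_of_memLp_two (h.memLp _) (h.memLp _))] at h0
  have h1 := h.integral k (X ^ k) (by simp)
  rw [integral_eq_zero_of_ae] at h1
  · simp only [coeff_X_pow_self, mul_one, zero_eq_mul, Nat.cast_eq_zero, Nat.factorial_ne_zero,
      false_or] at h1
    exact he.ne' h1
  · filter_upwards [h0] with x hx
    have : (rodrigues A k 1).eval x = 0 := by simpa using hx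
    simp [this]

/-- If δ > 0, take N with Nδ > 1: for k = 2N + 1 the leading coefficient is a product of an odd
number of negative factors, contradicting `lead_pos`. -/
theorem delta_nonpos (h : IsRodriguesSystem μ A δ e) (he : ∀ k, 0 < e k) : δ ≤ 0 := by
  by_contra! hδ
  obtain ⟨N, hN⟩ := exists_nat_gt (1 / δ)
  have hN' : 1 < N * δ := by rwa [div_lt_iff₀ hδ] at hN
  have hpos := h.lead_pos (he (2 * N + 1))
  have : lead δ (2 * N + 1) =
      - ∏ j ∈ Finset.range (2 * N + 1), (((j : ℝ) + (2 * N + 1 : ℕ) - 1) * δ - 1) := by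
    rw [lead, Finset.prod_congr rfl fun j _ => (neg_sub _ _).symm, Finset.prod_neg]
    simp [pow_succ, pow_mul]
  have h2 : 0 < ∏ j ∈ Finset.range (2 * N + 1), (((j : ℝ) + (2 * N + 1 : ℕ) - 1) * δ - 1) := by
    refine Finset.prod_pos fun j _ => ?_
    push_cast
    have : 0 ≤ (j + N : ℝ) * δ := by positivity
    nlinarith
  linarith

/-- A function orthogonal to all Rodrigues polynomials vanishes. -/
theorem ae_eq_zero (h : IsRodriguesSystem μ A δ e)
    (hdeg : ∀ k, e k = 0 → ∃ M : ℝ[X], M.Monic ∧ M.natDegree = k ∧ ∀ᵐ x ∂μ, M.eval x = 0)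
    {g : ℝ → ℝ} (hg : MemLp g 2 μ)
    (h0 : ∀ k, ∫ x, (rodrigues A k 1).eval x * g x ∂μ = 0) : g =ᵐ[μ] 0 := by
  have hi : ∀ p : ℝ[X], Integrable (fun x => p.eval x * g x) μ := fun p =>
    integrable_mul_of_memLp_two (h.memLp p) hg
  have key : ∀ (n : ℕ) (p : ℝ[X]), p.natDegree < n → ∫ x, p.eval x * g x ∂μ = 0 := by
    intro n
    induction n with
    | zero => intro p hp; omega
    | succ k ih =>
      -- A polynomial orthogonal to g with top coefficient 1, used to lower the degree: P_k
      -- normalised, or one vanishing almost everywhere when e_k = 0.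
      have hk : ∃ M : ℝ[X], M.coeff k = 1 ∧ M.natDegree ≤ k ∧ ∫ x, M.eval x * g x ∂μ = 0 := by
        rcases (h.nonneg k).eq_or_lt with hek | hek
        · obtain ⟨M, hM, hd, hv⟩ := hdeg k hek.symm
          refine ⟨M, by simpa [hd] using hM.coeff_natDegree, hd.le, integral_eq_zero_of_ae ?_⟩
          filter_upwards [hv] with x hx
          simp [hx]
        · refine ⟨C (lead δ k)⁻¹ * rodrigues A k 1, ?_,
            (natDegree_C_mul_le _ _).trans (h.natDegree_le k), ?_⟩
          · rw [coeff_C_mul, h.coeff_eq, inv_mul_cancel₀ (h.lead_pos hek).ne']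
          · simp only [eval_mul, eval_C, mul_assoc, integral_const_mul, h0, mul_zero]
      obtain ⟨M, hM1, hM2, hM3⟩ := hk
      intro p hp
      have hlow : ∫ x, (p - C (p.coeff k) * M).eval x * g x ∂μ = 0 := by
        -- For k = 0 no smaller `natDegree` exists; there the difference is the zero polynomial.
        rcases Nat.eq_zero_or_pos k with rfl | hkpos
        · have hp0 := eq_C_of_natDegree_le_zero (Nat.lt_succ_iff.1 hp)
          have hM0 := eq_C_of_natDegree_le_zero hM2
          rw [hM1] at hM0
          rw [hp0, hM0]; simp
        · refine ih _ (Nat.lt_of_le_pred hkpos (natDegree_le_iff_coeff_eq_zero.2 ?_))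
          intro i hik
          have hi : k ≤ i := Nat.le_of_pred_lt hik
          rcases hi.eq_or_lt with rfl | hlt
          · simp [hM1]
          · rw [coeff_sub, coeff_C_mul, coeff_eq_zero_of_natDegree_lt (by omega),
              coeff_eq_zero_of_natDegree_lt (hM2.trans_lt hlt)]
            simp
      have hsplit : ∀ x, (p - C (p.coeff k) * M).eval x * g x =
          p.eval x * g x - p.coeff k * (M.eval x * g x) := fun x => by simp; ring
      simp only [hsplit] at hlow
      rw [integral_sub (hi p) ((hi M).const_mul _), integral_const_mul, hM3] at hlow
      simpa using hlow
  refine ae_eq_zero_of_forall_integral_pow_mul h.mgf hg fun n => ?_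
  simpa using key (n + 1) (X ^ n) (by simp)

/-- Parseval's identity for Rodrigues polynomials, written as a covariance expansion. -/
theorem hasSum_cov (h : IsRodriguesSystem μ A δ e)
    (hdeg : ∀ k, e k = 0 → ∃ M : ℝ[X], M.Monic ∧ M.natDegree = k ∧ ∀ᵐ x ∂μ, M.eval x = 0)
    {g₁ g₂ : ℝ → ℝ} (hg₁ : MemLp g₁ 2 μ) (hg₂ : MemLp g₂ 2 μ) :
    HasSum (fun n : ℕ => ((∫ x, (rodrigues A (n + 1) 1).eval x * g₁ x ∂μ) *
        (∫ x, (rodrigues A (n + 1) 1).eval x * g₂ x ∂μ)) /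
        ((n + 1).factorial * e (n + 1) * lead δ (n + 1)))
      (cov[g₁, g₂; μ]) := by
  let φ : ℕ → Lp ℝ 2 μ := fun k => (h.memLp (rodrigues A k 1)).toLp
  have hin : ∀ (k : ℕ) {g : ℝ → ℝ} (hg : MemLp g 2 μ),
      inner ℝ (φ k) hg.toLp = ∫ x, (rodrigues A k 1).eval x * g x ∂μ := by
    intro k g hg
    rw [L2.inner_def]
    refine integral_congr_ae ?_
    filter_upwards [(h.memLp (rodrigues A k 1)).coeFn_toLp, hg.coeFn_toLp] with x h1 h2
    simp [φ, h1, h2, mul_comm]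
  have hnorm : ∀ k, ‖φ k‖ ^ 2 = k.factorial * e k * lead δ k := by
    intro k
    rw [← real_inner_self_eq_norm_sq, hin, h.integral_sq]
  -- For finite support some P_k vanish in L². They are left out of the basis, and their terms are
  -- zero in the series because the denominator is the squared norm.
  let I := {k : ℕ // φ k ≠ 0}
  let v : I → Lp ℝ 2 μ := fun k => (‖φ k‖⁻¹ : ℝ) • φ k
  have hv : Orthonormal ℝ v := by
    refine ⟨fun k => ?_, fun k l hkl => ?_⟩
    · rw [norm_smul, norm_inv, norm_norm, inv_mul_cancel₀ (norm_ne_zero_iff.2 k.2)]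
    · have : inner ℝ (φ k) (φ l) = 0 := by
        rw [hin, h.integral_eq_zero (fun he => hkl (Subtype.ext he))]
      simp [v, inner_smul_left, inner_smul_right, this]
  have hbot : (Submodule.span ℝ (Set.range v))ᗮ = ⊥ := by
    rw [Submodule.eq_bot_iff]
    intro w hw
    have hw' : ∀ k, inner ℝ (φ k) w = 0 := by
      intro k
      by_cases hk : φ k = 0
      · simp [hk]
      · have := (Submodule.mem_orthogonal _ _).1 hw (v ⟨k, hk⟩) (Submodule.subset_span ⟨_, rfl⟩)
        simpa [v, inner_smul_left, hk] using this
    have hz := h.ae_eq_zero hdeg (Lp.memLp w) fun k => by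
      rw [← hin k (Lp.memLp w), Lp.toLp_coeFn, hw']
    exact (Lp.eq_zero_iff_ae_eq_zero).2 hz
  let b := HilbertBasis.mkOfOrthogonalEqBot hv hbot
  have hb : ⇑b = v := HilbertBasis.coe_mkOfOrthogonalEqBot hv hbot
  have hs := b.hasSum_inner_mul_inner hg₁.toLp hg₂.toLp
  let F : ℕ → ℝ := fun k => ((∫ x, (rodrigues A k 1).eval x * g₁ x ∂μ) *
        (∫ x, (rodrigues A k 1).eval x * g₂ x ∂μ)) / (k.factorial * e k * lead δ k)
  have hF : (fun i : I => inner ℝ hg₁.toLp (b i) * inner ℝ (b i) hg₂.toLp) =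
      F ∘ (fun i : I => (i : ℕ)) := by
    funext i
    simp only [hb, v, F, Function.comp, ← hnorm, ← hin _ hg₁, ← hin _ hg₂]
    rw [inner_smul_left, inner_smul_right, real_inner_comm]
    simp only [conj_trivial]
    ring
  rw [hF] at hs
  have hs2 : HasSum F (inner ℝ hg₁.toLp hg₂.toLp) := by
    refine (hasSum_subtype_iff_of_support_subset (s := {k | φ k ≠ 0}) ?_).1 hs
    intro k hk hk0
    apply hk
    simp only [F, ← hnorm]
    simp [hk0]
  -- P_0 = 1, so removing the term k = 0 subtracts the product of the means and leaves the
  -- covariance.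
  rw [← hasSum_nat_add_iff' 1] at hs2
  have e0 : F 0 = (∫ x, g₁ x ∂μ) * ∫ x, g₂ x ∂μ := by
    have h00 := h.integral_sq 0
    simp only [Pearson.rodrigues, eval_one, mul_one, Nat.factorial_zero] at h00
    simp only [F, Nat.factorial_zero, ← h00, Pearson.rodrigues]
    simp
  have e1 : inner ℝ hg₁.toLp hg₂.toLp = ∫ x, (g₁ * g₂) x ∂μ := by
    rw [L2.inner_def]
    refine integral_congr_ae ?_
    filter_upwards [hg₁.coeFn_toLp, hg₂.coeFn_toLp] with x h1 h2
    simp [h1, h2, mul_comm]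
  rw [Finset.sum_range_one, e0, e1, ← covariance_eq_sub hg₁ hg₂] at hs2
  exact hs2

end IsRodriguesSystem

/-! ### The covariance kernel and the first-order identity -/

/-- Since N ≥ 0, the integral of |N ψ| over the product is the integral of w|ψ|, so integrability of
wψ alone justifies Fubini. -/
theorem integrable_and_integral_of_kernel {α : Type*} [MeasurableSpace α] {μ ν : Measure α}
    [SFinite μ] [SFinite ν] {N : α → α → ℝ} (hN : Measurable (Function.uncurry N))
    (h0 : ∀ x t, 0 ≤ N x t) {w ψ : α → ℝ} (hNi : ∀ t, Integrable (fun x => N x t) μ)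
    (hw : ∀ t, ∫ x, N x t ∂μ = w t) (hψ : AEStronglyMeasurable ψ ν)
    (hI : Integrable (fun t => w t * ψ t) ν) :
    Integrable (fun x => ∫ t, N x t * ψ t ∂ν) μ ∧
      ∫ x, ∫ t, N x t * ψ t ∂ν ∂μ = ∫ t, w t * ψ t ∂ν := by
  have hInt : Integrable (fun p : α × α => N p.1 p.2 * ψ p.2) (μ.prod ν) := by
    have hmeas : AEStronglyMeasurable (fun p : α × α => N p.1 p.2 * ψ p.2) (μ.prod ν) :=
      hN.aestronglyMeasurable.mul hψ.comp_snd
    rw [integrable_prod_iff' hmeas]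
    refine ⟨ae_of_all _ fun t => (hNi t).mul_const (ψ t), hI.norm.congr (ae_of_all _ fun t => ?_)⟩
    have hwt : 0 ≤ w t := hw t ▸ integral_nonneg fun x => h0 x t
    simp only [norm_mul, Real.norm_of_nonneg (h0 _ _), integral_mul_const, hw,
      Real.norm_of_nonneg hwt]
  refine ⟨hInt.integral_prod_left, ?_⟩
  rw [integral_integral_swap hInt]
  simp only [integral_mul_const, hw]

section Kernel

variable {α : Type*} [MeasurableSpace α] [TopologicalSpace α] [LinearOrder α]
  [OrderClosedTopology α] [OpensMeasurableSpace α]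

theorem setIntegral_Ioi_sub_eq {μ : Measure α} [IsProbabilityMeasure μ] {ι : α → ℝ}
    (hInt : Integrable ι μ) {m : ℝ} (hm : ∫ x, ι x ∂μ = m) (t : α) :
    ∫ x in Set.Ioi t, (ι x - m) ∂μ = ∫ x in Set.Iic t, (m - ι x) ∂μ := by
  have h1 := integral_add_compl (measurableSet_Iic (a := t)) (hInt.sub (integrable_const m))
  have hz : ∫ x, (ι x - m) ∂μ = 0 := by
    rw [integral_sub hInt (integrable_const m), hm]; simp
  simp only [Pi.sub_apply] at h1
  rw [hz, Set.compl_Iic] at h1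
  have h2 : ∫ x in Set.Iic t, (m - ι x) ∂μ = - ∫ x in Set.Iic t, (ι x - m) ∂μ := by
    rw [← integral_neg]; simp
  linarith

/-- The nonnegative kernel behind the covariance identity. -/
noncomputable def steinKernel (ι : α → ℝ) (m : ℝ) (c : α) (x t : α) : ℝ :=
  if c ≤ t then (if t < x then ι x - m else 0) else (if x ≤ t then m - ι x else 0)

variable [SecondCountableTopology α]

theorem measurable_steinKernel {ι : α → ℝ} (hι : Measurable ι) (m : ℝ) (c : α) :
    Measurable (Function.uncurry (steinKernel ι m c)) := by
  have hι' : Measurable fun p : α × α => ι p.1 := hι.comp measurable_fst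
  refine Measurable.ite (measurableSet_le measurable_const measurable_snd) ?_ ?_
  · exact Measurable.ite (measurableSet_lt measurable_snd measurable_fst)
      (hι'.sub_const m) measurable_const
  · exact Measurable.ite (measurableSet_le measurable_fst measurable_snd)
      (hι'.const_sub m) measurable_const

/-- The covariance identity `E[(X - m) h(X)] = ∫ w h'`, where `w(t) = E[(m - X) 1_{X ≤ t}]`. -/
theorem stein_identity {μ ν : Measure α} [IsProbabilityMeasure μ] [SFinite ν] {ι : α → ℝ}
    (hι : Measurable ι) (hInt : Integrable ι μ) {m : ℝ} (hm : ∫ x, ι x ∂μ = m) {c : α}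
    (hc₁ : ∀ x, c < x → m ≤ ι x) (hc₂ : ∀ x, x < c → ι x ≤ m) {w ψ h : α → ℝ}
    (hw : ∀ t, ∫ x in Set.Iic t, (m - ι x) ∂μ = w t)
    (hψ : AEStronglyMeasurable ψ ν) (hI : Integrable (fun t => w t * ψ t) ν)
    (hh : ∀ᵐ x ∂μ, ∫ t, steinKernel ι m c x t * ψ t ∂ν = (ι x - m) * (h x - h c)) :
    Integrable (fun x => (ι x - m) * h x) μ ∧ ∫ x, (ι x - m) * h x ∂μ = ∫ t, w t * ψ t ∂ν := by
  have hi1 : Integrable (fun x => m - ι x) μ := (integrable_const m).sub hInt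
  have hi2 : Integrable (fun x => ι x - m) μ := hInt.sub (integrable_const m)
  have hz : ∫ x, (ι x - m) ∂μ = 0 := by
    rw [integral_sub hInt (integrable_const m), hm]; simp
  have hk1 : ∀ t, c ≤ t → (fun x => steinKernel ι m c x t) =
      (Set.Ioi t).indicator fun x => ι x - m := by
    intro t ht; funext x; simp [steinKernel, ht, Set.indicator_apply]
  have hk2 : ∀ t, ¬ c ≤ t → (fun x => steinKernel ι m c x t) =
      (Set.Iic t).indicator fun x => m - ι x := by
    intro t ht; funext x; simp [steinKernel, ht, Set.indicator_apply]
  obtain ⟨h1, h2⟩ := integrable_and_integral_of_kernel (μ := μ) (ν := ν)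
    (measurable_steinKernel hι m c)
    (fun x t => by
      unfold steinKernel
      split_ifs with h1 h2 h3
      · linarith [hc₁ x (h1.trans_lt h2)]
      · exact le_rfl
      · linarith [hc₂ x (h3.trans_lt (not_le.1 h1))]
      · exact le_rfl) (w := w)
    (fun t => by
      by_cases ht : c ≤ t
      · rw [hk1 t ht]; exact hi2.indicator measurableSet_Ioi
      · rw [hk2 t ht]; exact hi1.indicator measurableSet_Iic)
    (fun t => by
      by_cases ht : c ≤ t
      · rw [hk1 t ht, integral_indicator measurableSet_Ioi, ← hw t,
          setIntegral_Ioi_sub_eq hInt hm]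
      · rw [hk2 t ht, integral_indicator measurableSet_Iic, hw t]) hψ hI
  -- The kernel yields only h(x) - h(c); the constant h(c) is free because ι - m has mean zero.
  have hadd : ∀ᵐ x ∂μ, (∫ t, steinKernel ι m c x t * ψ t ∂ν) + h c * (ι x - m) =
      (ι x - m) * h x := by
    filter_upwards [hh] with x hx
    rw [hx]; ring
  refine ⟨(h1.add (hi2.const_mul (h c))).congr hadd, ?_⟩
  rw [← integral_congr_ae hadd, integral_add h1 (hi2.const_mul (h c)), h2, integral_const_mul, hz]
  simp

end Kernel

/-! ### Iterating the covariance identity -/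

section Chain

/-- The operator that turns `E[v(X) G_{j+1}(X)]` into an expectation of `G_j(X)`. -/
noncomputable def adjointOp (t m : ℝ) (B : ℕ → ℝ[X] → ℝ[X]) (j : ℕ) (v : ℝ[X]) : ℝ[X] :=
  (X - C m) * taylor (-t) v - B j (taylor (-t) v)

variable {α : Type*} [MeasurableSpace α]

/-- Each function of the sequence `G` is linked to the next one by a first-order covariance
identity with polynomial weights. -/
def IsSteinChain (μ : Measure α) (ι : α → ℝ) (t m : ℝ) (B : ℕ → ℝ[X] → ℝ[X])
    (G : ℕ → α → ℝ) : Prop :=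
  ∀ (j : ℕ) (u : ℝ[X]), Integrable (fun x => (B j u).eval (ι x) * G j x) μ →
    Integrable (fun x => (taylor t u).eval (ι x) * G (j + 1) x) μ →
    Integrable (fun x => (ι x - m) * (u.eval (ι x) * G j x)) μ ∧
      ∫ x, (ι x - m) * (u.eval (ι x) * G j x) ∂μ =
        ∫ x, ((taylor t u).eval (ι x) * G (j + 1) x + (B j u).eval (ι x) * G j x) ∂μ

variable {μ : Measure α} {ι : α → ℝ} {t m : ℝ} {B : ℕ → ℝ[X] → ℝ[X]} {G : ℕ → α → ℝ}

/-- The identity is used with u = `taylor (-t) v`, so that its shift by t gives back the weight v on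
G_{k+1}. -/
theorem IsSteinChain.integral_rodrigues (h : IsSteinChain μ ι t m B G)
    (hG : ∀ (j : ℕ) (u : ℝ[X]), Integrable (fun x => u.eval (ι x) * G j x) μ) (k : ℕ) :
    ∀ v : ℝ[X], ∫ x, v.eval (ι x) * G k x ∂μ =
      ∫ x, (rodrigues (adjointOp t m B) k v).eval (ι x) * G 0 x ∂μ := by
  induction k with
  | zero => intro v; rfl
  | succ k ih =>
    intro v
    rw [rodrigues, ← ih]
    obtain ⟨-, h2⟩ := h k (taylor (-t) v) (hG _ _) (hG _ _)
    rw [integral_add (hG _ _) (hG _ _), taylor_taylor, add_neg_cancel, taylor_zero] at h2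
    have h3 : ∀ x, (adjointOp t m B k v).eval (ι x) * G k x =
        ((X - C m) * taylor (-t) v).eval (ι x) * G k x -
          (B k (taylor (-t) v)).eval (ι x) * G k x := fun x => by
      rw [adjointOp, eval_sub, sub_mul]
    simp only [h3]
    rw [integral_sub (hG _ _) (hG _ _)]
    simp only [eval_mul, eval_sub, eval_X, eval_C, mul_assoc]
    rw [h2]; ring

/-- If the operators `B j` do not raise degrees, integrability of the `G j` propagates to
polynomial weights. -/
theorem IsSteinChain.integrable (h : IsSteinChain μ ι t m B G)
    (hB : ∀ j u, (B j u).natDegree ≤ u.natDegree) (hG : ∀ j, Integrable (G j) μ) (j : ℕ)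
    (u : ℝ[X]) : Integrable (fun x => u.eval (ι x) * G j x) μ := by
  have key : ∀ (n j : ℕ) (u : ℝ[X]), u.natDegree ≤ n →
      Integrable (fun x => u.eval (ι x) * G j x) μ := by
    intro n
    induction n with
    | zero =>
      intro j u hu
      rw [eq_C_of_natDegree_le_zero hu]
      simpa using (hG j).const_mul _
    | succ n ih =>
      intro j u hu
      -- Write u = (x - m)u₁ + u(m). The chain needs integrability for weights of degree at most n
      -- only, at both j and j + 1, and returns that of (x - m)u₁ G_j; hence the induction runs over
      -- all j at once.
      have hd : (u /ₘ (X - C m)).natDegree ≤ n := by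
        rw [natDegree_divByMonic _ (monic_X_sub_C m), natDegree_X_sub_C]; omega
      obtain ⟨h1, -⟩ := h j (u /ₘ (X - C m)) (ih _ _ ((hB _ _).trans hd))
        (ih _ _ ((natDegree_taylor _ _).le.trans hd))
      refine (h1.add ((hG j).const_mul (u.eval m))).congr (ae_of_all _ fun x => ?_)
      have h2 := congrArg (eval (ι x)) (modByMonic_add_div u (X - C m))
      rw [modByMonic_X_sub_C_eq_C_eval] at h2
      simp only [eval_add, eval_mul, eval_sub, eval_X, eval_C] at h2
      simp only [Pi.add_apply]
      rw [← h2]; ring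
  exact key _ j u le_rfl

end Chain

/-! ### The continuous case: operators and integration by parts -/

/-- The polynomial `δ X² + β X + γ`. -/
noncomputable def quadPoly (δ β γ : ℝ) : ℝ[X] := C δ * X ^ 2 + C β * X + C γ

theorem eval_quadPoly (δ β γ x : ℝ) : (quadPoly δ β γ).eval x = quad δ β γ x := by
  simp [quadPoly, quad]

/-- The degree count shared by both cases: w is the derivative of v with ε = 0, or its backward
difference with ε = 1, where v - w is the shift v(x - 1). In both, x²w has top coefficient d times
that of v. -/
theorem natDegree_and_coeff_of_lower {δ β γ m ε a b : ℝ} {d : ℕ} {v w : ℝ[X]}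
    (hv : v.natDegree ≤ d) (hw : ∀ n, d ≤ n → w.coeff n = 0)
    (hw' : (X ^ 2 * w).coeff (d + 1) = d * v.coeff d) :
    ((X - C m) * (v - C ε * w) - (C a * X + C b) * v - quadPoly δ β γ * w).natDegree ≤ d + 1 ∧
    ((X - C m) * (v - C ε * w) - (C a * X + C b) * v - quadPoly δ β γ * w).coeff (d + 1) =
      (1 - a - d * δ) * v.coeff d := by
  have hv' : ∀ n, d < n → v.coeff n = 0 := fun n hn =>
    coeff_eq_zero_of_natDegree_lt (hv.trans_lt hn)
  have hexp : ∀ n, ((X - C m) * (v - C ε * w) - (C a * X + C b) * v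
      - quadPoly δ β γ * w).coeff (n + 1) =
      v.coeff n - ε * w.coeff n - m * (v.coeff (n + 1) - ε * w.coeff (n + 1))
        - (a * v.coeff n + b * v.coeff (n + 1))
        - (δ * (X ^ 2 * w).coeff (n + 1) + β * w.coeff n + γ * w.coeff (n + 1)) := by
    intro n
    simp only [quadPoly, coeff_sub, sub_mul, add_mul, coeff_add, mul_assoc, coeff_C_mul,
      coeff_X_mul]
  constructor
  · rw [natDegree_le_iff_coeff_eq_zero]
    intro N hN
    obtain ⟨n, rfl⟩ : ∃ n, N = n + 2 := ⟨N - 2, by omega⟩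
    rw [show n + 2 = n + 1 + 1 from rfl, hexp, show n + 1 + 1 = n + 2 from rfl, coeff_X_pow_mul,
      hv' _ (by omega), hv' _ (by omega), hw _ (by omega), hw _ (by omega), hw _ (by omega)]
    simp
  · rw [hexp, hw', hv' (d + 1) (by omega), hw _ le_rfl, hw (d + 1) (by omega)]
    ring

/-- The lower-order part of the continuous adjoint operator. -/
noncomputable def derivOp (Q : ℝ[X]) (j : ℕ) (u : ℝ[X]) : ℝ[X] :=
  Q * derivative u + C (j : ℝ) * derivative Q * u

theorem derivative_quadPoly (δ β γ : ℝ) :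
    derivative (quadPoly δ β γ) = C (2 * δ) * X + C β := by
  have h2 : (C 2 : ℝ[X]) = 2 := map_ofNat C 2
  simp only [quadPoly, derivative_add, derivative_mul, derivative_C, derivative_X_pow,
    derivative_X, C_mul, h2]
  simp only [Nat.cast_ofNat, h2]
  ring

theorem isRaising_derivOp (δ β γ m : ℝ) :
    IsRaising (adjointOp 0 m (derivOp (quadPoly δ β γ))) δ := by
  intro j d v hv
  have h := natDegree_and_coeff_of_lower (δ := δ) (β := β) (γ := γ) (m := m) (ε := 0)
    (a := 2 * j * δ) (b := j * β) (w := derivative v) hv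
    (fun n hn => by
      rw [coeff_derivative, coeff_eq_zero_of_natDegree_lt (by omega), zero_mul])
    (by
      rcases d with _ | d
      · rw [coeff_X_pow_mul']; simp
      · rw [coeff_X_pow_mul, coeff_derivative]; push_cast; ring)
  have e : adjointOp 0 m (derivOp (quadPoly δ β γ)) j v =
      (X - C m) * (v - C 0 * derivative v) - (C (2 * j * δ) * X + C (j * β)) * v
        - quadPoly δ β γ * derivative v := by
    simp only [adjointOp, derivOp, derivative_quadPoly, neg_zero, taylor_zero]
    simp only [C_mul, C_0]
    ring
  rw [e]
  refine ⟨h.1, h.2.trans ?_⟩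
  ring

theorem natDegree_derivOp_le {β γ : ℝ} (j : ℕ) (u : ℝ[X]) :
    (derivOp (quadPoly 0 β γ) j u).natDegree ≤ u.natDegree := by
  have hQ : (quadPoly 0 β γ).natDegree ≤ 1 := by
    simp only [quadPoly, C_0, zero_mul, zero_add]
    exact natDegree_linear_le
  refine natDegree_add_le_of_degree_le ?_ ?_
  · by_cases hu : u.natDegree = 0
    · rw [derivative_of_natDegree_zero hu]; simp
    · exact natDegree_mul_le.trans (by have := natDegree_derivative_lt hu; omega)
  · rw [derivative_quadPoly]
    refine (natDegree_mul_le).trans ?_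
    rw [mul_zero, C_0, zero_mul, zero_add, ← C_mul, natDegree_C, zero_add]

/-- The analytic content of the continuous Pearson identity for the law `μ` of the variable. -/
structure IsSteinDiff (μ : Measure ℝ) (S : Set ℝ) (m : ℝ) (Q : ℝ[X]) : Prop where
  isOpen : IsOpen S
  ae_mem : ∀ᵐ x ∂μ, x ∈ S
  pos : ∀ x ∈ S, 0 < Q.eval x
  stein : ∀ h h' : ℝ → ℝ, (∀ x ∈ S, HasDerivAt h (h' x) x) → ContinuousOn h' S →
    Integrable (fun x => Q.eval x * h' x) μ →
    Integrable (fun x => (x - m) * h x) μ ∧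
      ∫ x, (x - m) * h x ∂μ = ∫ x, Q.eval x * h' x ∂μ

theorem IsSteinDiff.integral_pow_pos {μ : Measure ℝ} [IsProbabilityMeasure μ] {S : Set ℝ} {m : ℝ}
    {Q : ℝ[X]} (hS : IsSteinDiff μ S m Q) (hμ : FiniteMGFNearZero id μ) (k : ℕ) :
    0 < ∫ x, Q.eval x ^ k ∂μ := by
  have hi : Integrable (fun x => Q.eval x ^ k) μ := by
    simpa using (memLp_eval (zero_mem_interior_integrableExpSet hμ) (Q ^ k)).integrable
      (by norm_num)
  have hnn : 0 ≤ᵐ[μ] fun x => Q.eval x ^ k := by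
    filter_upwards [hS.ae_mem] with x hx
    exact pow_nonneg (hS.pos x hx).le k
  refine (integral_nonneg_of_ae hnn).lt_of_ne fun h0 => ?_
  have h1 := (integral_eq_zero_iff_of_nonneg_ae hnn hi).1 h0.symm
  obtain ⟨x, hx, hxS⟩ := (h1.and hS.ae_mem).exists
  exact (pow_pos (hS.pos x hxS) k).ne' hx

/-- Product rule: Q(u Q^j D_j)' = u Q^{j+1} D_{j+1} + (Q u' + j Q' u) Q^j D_j. -/
theorem IsSteinDiff.isSteinChain {μ : Measure ℝ} {S : Set ℝ} {m : ℝ} {Q : ℝ[X]}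
    (hS : IsSteinDiff μ S m Q) {D : ℕ → ℝ → ℝ}
    (hD : ∀ j, ∀ x ∈ S, HasDerivAt (D j) (D (j + 1) x) x) :
    IsSteinChain μ id 0 m (derivOp Q) (fun j x => Q.eval x ^ j * D j x) := by
  intro j u h1 h2
  simp only [id, taylor_zero] at h1 h2 ⊢
  have hc : ∀ j, ContinuousOn (D j) S := fun j x hx => (hD j x hx).continuousAt.continuousWithinAt
  let h : ℝ → ℝ := fun x => u.eval x * (Q.eval x ^ j * D j x)
  let h' : ℝ → ℝ := fun x => (derivative u).eval x * (Q.eval x ^ j * D j x) +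
    u.eval x * ((j * Q.eval x ^ (j - 1) * (derivative Q).eval x) * D j x +
      Q.eval x ^ j * D (j + 1) x)
  have hQh : ∀ x, Q.eval x * h' x = u.eval x * (Q.eval x ^ (j + 1) * D (j + 1) x) +
      (derivOp Q j u).eval x * (Q.eval x ^ j * D j x) := by
    intro x
    simp only [h', derivOp, eval_add, eval_mul, eval_C]
    rcases j with _ | j
    · simp; ring
    · simp only [Nat.add_sub_cancel]; ring
  have hs := hS.stein h h' (fun x hx => ?_) ?_ ?_
  · simpa only [hQh] using hs
  · exact (u.hasDerivAt x).mul (((Q.hasDerivAt x).pow j).mul (hD j x hx))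
  · have := hc j
    have := hc (j + 1)
    fun_prop
  · simp only [hQh]
    exact h2.add h1

theorem IsSteinDiff.isRodriguesSystem {μ : Measure ℝ} [IsProbabilityMeasure μ] {S : Set ℝ}
    {m δ β γ : ℝ} (hS : IsSteinDiff μ S m (quadPoly δ β γ)) (hμ : FiniteMGFNearZero id μ) :
    IsRodriguesSystem μ (adjointOp 0 m (derivOp (quadPoly δ β γ))) δ
      (fun k => ∫ x, (quadPoly δ β γ).eval x ^ k ∂μ) := by
  refine ⟨hμ, isRaising_derivOp _ _ _ _, fun k => ?_, fun k u hu => ?_⟩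
  · refine integral_nonneg_of_ae ?_
    filter_upwards [hS.ae_mem] with x hx
    exact pow_nonneg (hS.pos x hx).le k
  · have hchain := hS.isSteinChain (D := fun j x => (derivative^[j] u).eval x) fun j x _ => by
      rw [Function.iterate_succ_apply']
      exact (derivative^[j] u).hasDerivAt x
    have hInt := zero_mem_interior_integrableExpSet hμ
    have h := hchain.integral_rodrigues (fun j v => by
      have := (memLp_eval hInt (v * (quadPoly δ β γ ^ j * derivative^[j] u))).integrable
        (by norm_num)
      simpa using this) k 1
    have hconst : ∀ x, (derivative^[k] u).eval x = k.factorial * u.coeff k := by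
      intro x
      have h0 : (derivative^[k] u).natDegree ≤ 0 := by
        have := natDegree_iterate_derivative u k; omega
      rw [eq_C_of_natDegree_le_zero h0, eval_C, coeff_iterate_derivative]
      simp [Nat.descFactorial_self]
    simp only [id, Function.iterate_zero, pow_zero, one_mul, eval_one, hconst] at h
    rw [← h, integral_mul_const]
    ring

/-- For |x| ≥ 1 the quadratic is at most |x|(δ|x| + |β| + |γ|), which is negative beyond the chosen
radius. -/
theorem bounded_of_quad_nonneg {δ β γ : ℝ} (hδ : δ < 0) :
    ∃ R, ∀ x, 0 ≤ (quadPoly δ β γ).eval x → |x| ≤ R := by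
  refine ⟨(|β| + |γ|) / (-δ) + 1, fun x hx => ?_⟩
  rw [eval_quadPoly, quad] at hx
  by_contra! hlt
  have hδ' : 0 < -δ := by linarith
  have h1 : 1 ≤ |x| := by
    have : 0 ≤ (|β| + |γ|) / (-δ) := by positivity
    linarith
  have h2 : (|β| + |γ|) < (|x| - 1) * (-δ) := by
    rw [← div_lt_iff₀ hδ']; linarith
  have h3 : β * x ≤ |β| * |x| := by rw [← abs_mul]; exact le_abs_self _
  have h4 : γ ≤ |γ| * |x| := (le_abs_self γ).trans (le_mul_of_one_le_right (abs_nonneg _) h1)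
  rw [← sq_abs x] at hx
  nlinarith

/-- Integrals of Rodrigues polynomials against a smooth function. -/
theorem IsSteinDiff.integral_rodrigues {μ : Measure ℝ} [IsProbabilityMeasure μ] {S : Set ℝ}
    {m δ β γ : ℝ} (hS : IsSteinDiff μ S m (quadPoly δ β γ)) (hμ : FiniteMGFNearZero id μ)
    {D : ℕ → ℝ → ℝ} (hD : ∀ j, ∀ x ∈ S, HasDerivAt (D j) (D (j + 1) x) x)
    (hI : ∀ j, Integrable (fun x => (quadPoly δ β γ).eval x ^ j * D j x) μ) (k : ℕ) :
    ∫ x, (quadPoly δ β γ).eval x ^ k * D k x ∂μ =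
      ∫ x, (rodrigues (adjointOp 0 m (derivOp (quadPoly δ β γ))) k 1).eval x * D 0 x ∂μ := by
  have hsys := hS.isRodriguesSystem hμ
  have hδ : δ ≤ 0 := hsys.delta_nonpos (hS.integral_pow_pos hμ)
  have hchain := hS.isSteinChain hD
  have hall : ∀ (j : ℕ) (u : ℝ[X]),
      Integrable (fun x => u.eval (id x) * ((quadPoly δ β γ).eval x ^ j * D j x)) μ := by
    intro j u
    rcases hδ.eq_or_lt with rfl | hneg
    · exact hchain.integrable (fun j u => natDegree_derivOp_le j u) hI j u
    · obtain ⟨R, hR⟩ := bounded_of_quad_nonneg (β := β) (γ := γ) hneg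
      obtain ⟨K, hK⟩ := (isCompact_Icc (a := -R) (b := R)).exists_bound_of_continuousOn
        (f := fun x => u.eval x) u.continuous.continuousOn
      refine (hI j).bdd_mul (c := K) u.continuous.aestronglyMeasurable ?_
      filter_upwards [hS.ae_mem] with x hx
      exact hK x (abs_le.1 (hR x (hS.pos x hx).le))
  have := hchain.integral_rodrigues hall k 1
  simpa using this

theorem integral_steinKernel_mul {S : Set ℝ} (hS : S.OrdConnected) {m x : ℝ} (hm : m ∈ S)
    (hx : x ∈ S) {h h' : ℝ → ℝ} (hd : ∀ y ∈ S, HasDerivAt h (h' y) y) (hc : ContinuousOn h' S) :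
    ∫ t, steinKernel id m m x t * S.indicator h' t = (x - m) * (h x - h m) := by
  have ftc : ∀ a ∈ S, ∀ b ∈ S, ∫ t in a..b, h' t = h b - h a := fun a ha b hb =>
    intervalIntegral.integral_eq_sub_of_hasDerivAt
      (fun y hy => hd y (hS.uIcc_subset ha hb hy))
      (hc.mono (hS.uIcc_subset ha hb)).intervalIntegrable
  rcases le_or_gt m x with hle | hlt
  · have e : (fun t => steinKernel id m m x t * S.indicator h' t) =
        (Set.Ico m x).indicator fun t => (x - m) * h' t := by
      funext t
      by_cases h1 : m ≤ t
      · by_cases h2 : t < x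
        · have : t ∈ S := hS.out hm hx ⟨h1, h2.le⟩
          simp [steinKernel, h1, h2, this]
        · simp [steinKernel, h1, h2]
      · have : ¬ x ≤ t := fun h3 => h1 (hle.trans h3)
        simp [steinKernel, h1, this]
    rw [e, integral_indicator measurableSet_Ico, integral_Ico_eq_integral_Ioc,
      ← intervalIntegral.integral_of_le hle, intervalIntegral.integral_const_mul, ftc m hm x hx]
  · have e : (fun t => steinKernel id m m x t * S.indicator h' t) =
        (Set.Ico x m).indicator fun t => (m - x) * h' t := by
      funext t
      by_cases h1 : m ≤ t
      · have : ¬ t < x := fun h3 => (h1.trans_lt h3).not_gt hlt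
        simp [steinKernel, h1, this]
      · by_cases h2 : x ≤ t
        · have : t ∈ S := hS.out hx hm ⟨h2, (not_le.1 h1).le⟩
          simp [steinKernel, h1, h2, this, not_le.1 h1]
        · simp [steinKernel, h1, h2]
    rw [e, integral_indicator measurableSet_Ico, integral_Ico_eq_integral_Ioc,
      ← intervalIntegral.integral_of_le hlt.le, intervalIntegral.integral_const_mul, ftc x hx m hm]
    ring

/-! ### The truncated mean and the support of a Pearson density -/

section Truncated

variable {μ : Measure ℝ} [IsProbabilityMeasure μ] {m : ℝ} {w : ℝ → ℝ}

theorem eq_integral_Ioi_of_integral_Iic (hInt : Integrable (fun x : ℝ => x) μ)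
    (hm : ∫ x, x ∂μ = m) (hw : ∀ t, ∫ x in Set.Iic t, (m - x) ∂μ = w t) (t : ℝ) :
    w t = ∫ x in Set.Ioi t, (x - m) ∂μ := by
  rw [setIntegral_Ioi_sub_eq hInt hm, hw]

theorem truncated_mono (hInt : Integrable (fun x : ℝ => x) μ)
    (hw : ∀ t, ∫ x in Set.Iic t, (m - x) ∂μ = w t) {a b : ℝ} (hab : a ≤ b) (hb : b ≤ m) :
    w a ≤ w b := by
  have hi : Integrable (fun x : ℝ => m - x) μ := (integrable_const m).sub hInt
  rw [← hw, ← hw]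
  refine setIntegral_mono_set hi.integrableOn ?_ (Set.Iic_subset_Iic.2 hab).eventuallyLE
  exact (ae_restrict_iff' measurableSet_Iic).2 (ae_of_all _ fun x hx =>
    sub_nonneg.2 ((Set.mem_Iic.1 hx).trans hb))

theorem truncated_anti (hInt : Integrable (fun x : ℝ => x) μ) (hm : ∫ x, x ∂μ = m)
    (hw : ∀ t, ∫ x in Set.Iic t, (m - x) ∂μ = w t) {a b : ℝ} (hab : a ≤ b) (ha : m ≤ a) :
    w b ≤ w a := by
  have hi : Integrable (fun x : ℝ => x - m) μ := hInt.sub (integrable_const m)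
  rw [eq_integral_Ioi_of_integral_Iic hInt hm hw, eq_integral_Ioi_of_integral_Iic hInt hm hw]
  refine setIntegral_mono_set hi.integrableOn ?_ (Set.Ioi_subset_Ioi hab).eventuallyLE
  exact (ae_restrict_iff' measurableSet_Ioi).2 (ae_of_all _ fun x hx =>
    sub_nonneg.2 (ha.trans (Set.mem_Ioi.1 hx).le))

theorem truncated_nonneg (hInt : Integrable (fun x : ℝ => x) μ) (hm : ∫ x, x ∂μ = m)
    (hw : ∀ t, ∫ x in Set.Iic t, (m - x) ∂μ = w t) (t : ℝ) : 0 ≤ w t := by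
  rcases le_total t m with h | h
  · rw [← hw]
    exact setIntegral_nonneg measurableSet_Iic fun x hx => sub_nonneg.2 ((Set.mem_Iic.1 hx).trans h)
  · rw [eq_integral_Ioi_of_integral_Iic hInt hm hw]
    exact setIntegral_nonneg measurableSet_Ioi fun x hx =>
      sub_nonneg.2 (h.trans (Set.mem_Ioi.1 hx).le)

/-- E|X - m| = 2w(m), so w(m) = 0 would put all mass at m. -/
theorem truncated_mean_pos (hInt : Integrable (fun x : ℝ => x) μ) (hm : ∫ x, x ∂μ = m)
    (hw : ∀ t, ∫ x in Set.Iic t, (m - x) ∂μ = w t) (hne : ∀ᵐ x ∂μ, x ≠ m) : 0 < w m := by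
  refine (truncated_nonneg hInt hm hw m).lt_of_ne fun h0 => ?_
  have hi : Integrable (fun x : ℝ => |x - m|) μ := (hInt.sub (integrable_const m)).abs
  have h1 := integral_add_compl (measurableSet_Iic (a := m)) hi
  rw [Set.compl_Iic, setIntegral_congr_fun (g := fun x => m - x) measurableSet_Iic
      (fun x hx => by
        have := Set.mem_Iic.1 hx
        simp only [abs_of_nonpos (sub_nonpos.2 this), neg_sub]), hw,
    setIntegral_congr_fun (g := fun x => x - m) measurableSet_Ioi
      (fun x hx => abs_of_pos (sub_pos.2 (Set.mem_Ioi.1 hx))),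
    ← eq_integral_Ioi_of_integral_Iic hInt hm hw, ← h0, add_zero] at h1
  have h2 := (integral_eq_zero_iff_of_nonneg (fun x => abs_nonneg _) hi).1 h1.symm
  obtain ⟨x, hx, hx'⟩ := (h2.and hne).exists
  exact hx' (sub_eq_zero.1 (abs_eq_zero.1 hx))

end Truncated

theorem continuous_setIntegral_Iic {g : ℝ → ℝ} (hg : Integrable g) :
    Continuous fun t => ∫ x in Set.Iic t, g x := by
  have e : (fun t => ∫ x in Set.Iic t, g x) =
      fun t => (∫ x in Set.Iic 0, g x) + ∫ x in (0 : ℝ)..t, g x := by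
    funext t
    rw [← intervalIntegral.integral_Iic_sub_Iic hg.integrableOn hg.integrableOn]; ring
  rw [e]
  exact continuous_const.add
    (intervalIntegral.continuous_primitive (fun a b => hg.intervalIntegrable) 0)

theorem FiniteMGFNearZero.map {Ω : Type*} [MeasurableSpace Ω] {P : Measure Ω} {Y : Ω → ℝ} (hY : AEMeasurable Y P)
    (h : FiniteMGFNearZero Y P) :
    FiniteMGFNearZero id (P.map Y) := by
  obtain ⟨t, ht, hI⟩ := h
  exact ⟨t, ht, fun s hs => (integrable_map_measure (by fun_prop) hY).2 (hI s hs)⟩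

section ContinuousCase

variable {Ω : Type*} [MeasurableSpace Ω] {P : Measure Ω} [IsProbabilityMeasure P] {X : Ω → ℝ}
  {f : ℝ → ℝ} {δ β γ : ℝ}

/-- S is the set where qf > 0. As a primitive, qf is continuous even if f is not, so S is open; as
qf increases up to m, decreases after it and is positive at m, S is an interval around m. Where f >
0, only the finitely many roots of q are missed. -/
theorem IsContinuous.exists_isSteinDiff (h : IsContinuous P X f δ β γ) :
    ∃ S ⊆ openSupport f, IsSteinDiff (P.map X) S (∫ ω, X ω ∂P) (quadPoly δ β γ) := by
  have hprob : IsProbabilityMeasure (P.map X) := Measure.isProbabilityMeasure_map h.aemeasurable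
  set m := ∫ ω, X ω ∂P with hmdef
  have hm : ∫ x, x ∂(P.map X) = m := integral_map h.aemeasurable (by fun_prop)
  have hInt : Integrable (fun x : ℝ => x) (P.map X) :=
    (integrable_map_measure (by fun_prop) h.aemeasurable).2 h.integrable
  have hid := h.identity
  simp only [← hmdef] at hid
  have hlaw := h.law
  have hf := h.density_nonneg
  have hfm := h.measurable_density
  generalize P.map X = μ at *
  have hfin : ∀ᵐ x, ENNReal.ofReal (f x) < ⊤ := ae_of_all _ fun _ => ENNReal.ofReal_lt_top
  have int_iff : ∀ g : ℝ → ℝ, Integrable g μ ↔ Integrable fun x => f x * g x := by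
    intro g
    rw [hlaw, integrable_withDensity_iff_integrable_smul₀' hfm.ennreal_ofReal.aemeasurable hfin]
    simp only [ENNReal.toReal_ofReal (hf _), smul_eq_mul]
  have int_eq : ∀ g : ℝ → ℝ, ∫ x, g x ∂μ = ∫ x, f x * g x := by
    intro g
    rw [hlaw, integral_withDensity_eq_integral_toReal_smul₀ hfm.ennreal_ofReal.aemeasurable hfin]
    simp only [ENNReal.toReal_ofReal (hf _), smul_eq_mul]
  have hw : ∀ t, ∫ x in Set.Iic t, (m - x) ∂μ = quad δ β γ t * f t := by
    intro t
    rw [← hid t, hlaw, setIntegral_withDensity_eq_setIntegral_toReal_smul₀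
      hfm.ennreal_ofReal.aemeasurable (ae_of_all _ fun _ => ENNReal.ofReal_lt_top) _
      measurableSet_Iic]
    simp only [ENNReal.toReal_ofReal (hf _), smul_eq_mul, mul_comm]
  have hac : ∀ {p : ℝ → Prop}, (∀ᵐ x, p x) → ∀ᵐ x ∂μ, p x := by
    intro p hp
    rw [hlaw]
    exact (withDensity_absolutelyContinuous _ _).ae_le hp
  have hcont : Continuous fun t => quad δ β γ t * f t := by
    have := continuous_setIntegral_Iic (g := fun x => (m - x) * f x) (by
      simpa only [mul_comm] using (int_iff fun x => m - x).1 ((integrable_const m).sub hInt))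
    simpa only [hid] using this
  have hnn := truncated_nonneg hInt hm hw
  have hmpos : 0 < quad δ β γ m * f m :=
    truncated_mean_pos (w := fun t => quad δ β γ t * f t) hInt hm hw (hac (Measure.ae_ne volume m))
  let S : Set ℝ := {t | 0 < quad δ β γ t * f t}
  have hSopen : IsOpen S := isOpen_lt continuous_const hcont
  have hSord : S.OrdConnected := ⟨fun a ha b hb z hz => by
    rcases le_total z m with hzm | hzm
    · exact lt_of_lt_of_le ha (truncated_mono hInt hw hz.1 hzm)
    · exact lt_of_lt_of_le hb (truncated_anti hInt hm hw hz.2 hzm)⟩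
  have hSf : ∀ x ∈ S, 0 < f x := fun x hx => (hf x).lt_of_ne fun h0 => by
    have hx' : 0 < quad δ β γ x * f x := hx
    rw [← h0, mul_zero] at hx'
    exact lt_irrefl _ hx'
  have hSq : ∀ x ∈ S, 0 < quad δ β γ x := fun x hx => pos_of_mul_pos_left hx (hf x)
  have hmem : ∀ᵐ x ∂μ, x ∈ S := by
    have hQ : quadPoly δ β γ ≠ 0 := fun h0 => by
      have := hSq m hmpos
      rw [← eval_quadPoly, h0, eval_zero] at this
      exact lt_irrefl _ this
    have hroot : ∀ᵐ x : ℝ, (quadPoly δ β γ).eval x ≠ 0 := by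
      have hfin := (quadPoly δ β γ).roots.toFinset.finite_toSet
      filter_upwards [hfin.countable.ae_notMem volume] with x hx h0
      exact hx (by simpa [hQ] using h0)
    rw [hlaw, ae_withDensity_iff hfm.ennreal_ofReal]
    filter_upwards [hroot] with x hx hfx
    refine (hnn x).lt_of_ne' (mul_ne_zero (by rwa [← eval_quadPoly]) ?_)
    rintro h0
    simp [h0] at hfx
  refine ⟨S, interior_maximal hSf hSopen, hSopen, hmem,
    fun x hx => by rw [eval_quadPoly]; exact hSq x hx, fun g g' hd hc hI => ?_⟩
  have hae : (fun x => (quadPoly δ β γ).eval x * g' x) =ᵐ[μ]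
      fun x => quad δ β γ x * S.indicator g' x := by
    filter_upwards [hmem] with x hx
    rw [Set.indicator_of_mem hx, eval_quadPoly]
  have hcomm : ∀ x, f x * (quad δ β γ x * S.indicator g' x) =
      quad δ β γ x * f x * S.indicator g' x := fun x => by ring
  have hI' := (int_iff _).1 (hI.congr hae)
  simp only [hcomm] at hI'
  have hst := stein_identity (μ := μ) (ν := volume) (ι := id) measurable_id hInt hm (c := m)
    (fun x hx => hx.le) (fun x hx => hx.le) (ψ := S.indicator g') (h := g) hw
    ((aestronglyMeasurable_indicator_iff hSopen.measurableSet).2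
      (hc.aestronglyMeasurable hSopen.measurableSet)) hI'
    (by
      filter_upwards [hmem] with x hx
      exact integral_steinKernel_mul hSord hmpos hx hd hc)
  refine ⟨hst.1, hst.2.trans ?_⟩
  rw [integral_congr_ae hae, int_eq]
  simp only [hcomm]

theorem IsContinuous.hasSum_covariance (h : IsContinuous P X f δ β γ)
    (hmgf : FiniteMGFNearZero X P) {g₁ g₂ : ℝ → ℝ} (hL₁ : MemLp g₁ 2 (P.map X))
    (hL₂ : MemLp g₂ 2 (P.map X))
    (hs₁ : ContDiffOn ℝ ((⊤ : ℕ∞) : WithTop ℕ∞) g₁ (openSupport f))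
    (hs₂ : ContDiffOn ℝ ((⊤ : ℕ∞) : WithTop ℕ∞) g₂ (openSupport f))
    (hI₁ : ∀ k : ℕ, Integrable (fun ω => quad δ β γ (X ω) ^ k * |iteratedDeriv k g₁ (X ω)|) P)
    (hI₂ : ∀ k : ℕ, Integrable (fun ω => quad δ β γ (X ω) ^ k * |iteratedDeriv k g₂ (X ω)|) P) :
    HasSum (fun n : ℕ => ((∫ ω, quad δ β γ (X ω) ^ (n + 1) * iteratedDeriv (n + 1) g₁ (X ω) ∂P) *
        (∫ ω, quad δ β γ (X ω) ^ (n + 1) * iteratedDeriv (n + 1) g₂ (X ω) ∂P)) /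
        (((n + 1).factorial : ℝ) * (∫ ω, quad δ β γ (X ω) ^ (n + 1) ∂P) *
          ∏ j ∈ Finset.Icc n (2 * n), (1 - (j : ℝ) * δ)))
      (covariance (fun ω => g₁ (X ω)) (fun ω => g₂ (X ω)) P) := by
  obtain ⟨S, hSf, hS⟩ := h.exists_isSteinDiff
  have hX := h.aemeasurable
  have hprob : IsProbabilityMeasure (P.map X) := Measure.isProbabilityMeasure_map hX
  have hμ := FiniteMGFNearZero.map hX hmgf
  have hsys := hS.isRodriguesSystem hμ
  have hsum := hsys.hasSum_cov
    (fun k hk => absurd hk (hS.integral_pow_pos hμ k).ne') hL₁ hL₂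
  have hderiv : ∀ {g : ℝ → ℝ}, ContDiffOn ℝ ((⊤ : ℕ∞) : WithTop ℕ∞) g (openSupport f) →
      ∀ j, ∀ x ∈ S, HasDerivAt (iteratedDeriv j g) (iteratedDeriv (j + 1) g x) x := by
    intro g hg j x hx
    rw [iteratedDeriv_succ]
    refine DifferentiableAt.hasDerivAt ?_
    have hd := hg.differentiableOn_iteratedDerivWithin (m := j)
      (by exact_mod_cast WithTop.coe_lt_top _) isOpen_interior.uniqueDiffOn
    exact ((hd.congr fun y hy => (iteratedDerivWithin_of_isOpen isOpen_interior hy).symm) x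
      (hSf hx)).differentiableAt (isOpen_interior.mem_nhds (hSf hx))
  have hmeas : ∀ {g : ℝ → ℝ}, ContDiffOn ℝ ((⊤ : ℕ∞) : WithTop ℕ∞) g (openSupport f) →
      ∀ k, AEStronglyMeasurable (fun x => quad δ β γ x ^ k * iteratedDeriv k g x) (P.map X) := by
    intro g hg k
    have hc : ContinuousOn (iteratedDeriv k g) S := fun x hx =>
      (hderiv hg k x hx).continuousAt.continuousWithinAt
    have h1 := hc.aestronglyMeasurable (μ := P.map X) hS.isOpen.measurableSet
    rw [Measure.restrict_eq_self_of_ae_mem hS.ae_mem] at h1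
    refine AEStronglyMeasurable.mul (Continuous.aestronglyMeasurable ?_) h1
    unfold quad; fun_prop
  have hInt : ∀ {g : ℝ → ℝ}, ContDiffOn ℝ ((⊤ : ℕ∞) : WithTop ℕ∞) g (openSupport f) →
      (∀ k : ℕ, Integrable (fun ω => quad δ β γ (X ω) ^ k * |iteratedDeriv k g (X ω)|) P) →
      ∀ k, ∫ ω, quad δ β γ (X ω) ^ k * iteratedDeriv k g (X ω) ∂P =
        ∫ x, (rodrigues (adjointOp 0 (∫ ω, X ω ∂P) (derivOp (quadPoly δ β γ))) k 1).eval x *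
          g x ∂(P.map X) := by
    intro g hg hI k
    have hI' : ∀ j, Integrable (fun x => (quadPoly δ β γ).eval x ^ j * iteratedDeriv j g x)
        (P.map X) := by
      intro j
      simp only [eval_quadPoly]
      rw [integrable_map_measure (hmeas hg j) hX]
      refine (hI j).mono ((hmeas hg j).comp_aemeasurable hX) (ae_of_all _ fun ω => ?_)
      simp
    have := hS.integral_rodrigues hμ (hderiv hg) hI' k
    simp only [eval_quadPoly, iteratedDeriv_zero] at this
    rw [integral_map hX (hmeas hg k)] at this
    exact this
  have hq : ∀ k, ∫ x, (quadPoly δ β γ).eval x ^ k ∂(P.map X) = ∫ ω, quad δ β γ (X ω) ^ k ∂P := by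
    intro k
    rw [integral_map hX (by fun_prop)]
    simp only [eval_quadPoly]
  simp only [hq, ← hInt hs₁ hI₁, ← hInt hs₂ hI₂, lead_succ] at hsum
  rw [covariance_map hL₁.1 hL₂.1 hX] at hsum
  exact hsum

end ContinuousCase

/-! ### The discrete case: operators and summation by parts -/

/-- The lower-order part of the discrete adjoint operator. -/
noncomputable def fwdOp (Q : ℝ[X]) (j : ℕ) (u : ℝ[X]) : ℝ[X] :=
  taylor 1 u * taylor (j : ℝ) Q - u * Q

theorem coeff_taylor_of_natDegree_le (r : ℝ) {v : ℝ[X]} {n : ℕ} (hv : v.natDegree ≤ n) :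
    (taylor r v).coeff n = v.coeff n := by
  rw [taylor_coeff, eval_eq_sum_range' (n := 1)]
  · simp [hasseDeriv_coeff]
  · have := natDegree_hasseDeriv_le v n; omega

theorem coeff_taylor_of_natDegree_le_succ (r : ℝ) {v : ℝ[X]} {n : ℕ} (hv : v.natDegree ≤ n + 1) :
    (taylor r v).coeff n = v.coeff n + (n + 1) * v.coeff (n + 1) * r := by
  rw [taylor_coeff, eval_eq_sum_range' (n := 2)]
  · simp [hasseDeriv_coeff, Finset.sum_range_succ, add_comm 1 n]
  · have := natDegree_hasseDeriv_le v n; omega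

theorem taylor_quadPoly (δ β γ r : ℝ) :
    taylor r (quadPoly δ β γ) = quadPoly δ β γ + (C (2 * r * δ) * X + C (δ * r ^ 2 + β * r)) := by
  have h2 : (C 2 : ℝ[X]) = 2 := map_ofNat C 2
  simp only [quadPoly, taylor_apply, add_comp, mul_comp, C_comp, X_comp, pow_comp, C_mul, C_add,
    C_pow, h2]
  ring

theorem isRaising_fwdOp (δ β γ m : ℝ) :
    IsRaising (adjointOp 1 m (fwdOp (quadPoly δ β γ))) δ := by
  intro j d v hv
  have h := natDegree_and_coeff_of_lower (δ := δ) (β := β) (γ := γ) (m := m) (ε := 1)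
    (a := 2 * j * δ) (b := δ * j ^ 2 + β * j) (w := v - taylor (-1) v) hv
    (fun n hn => by
      rw [coeff_sub, coeff_taylor_of_natDegree_le _ (hv.trans hn), sub_self])
    (by
      rcases d with _ | d
      · rw [coeff_X_pow_mul']; simp
      · rw [coeff_X_pow_mul, coeff_sub, coeff_taylor_of_natDegree_le_succ _ hv]; push_cast; ring)
  have e : adjointOp 1 m (fwdOp (quadPoly δ β γ)) j v =
      (X - C m) * (v - C 1 * (v - taylor (-1) v))
        - (C (2 * j * δ) * X + C (δ * j ^ 2 + β * j)) * v
        - quadPoly δ β γ * (v - taylor (-1) v) := by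
    simp only [adjointOp, fwdOp, taylor_quadPoly, taylor_taylor, add_neg_cancel, taylor_zero, C_1]
    ring
  rw [e]
  refine ⟨h.1, h.2.trans ?_⟩
  ring

theorem natDegree_fwdOp_le {β γ : ℝ} (j : ℕ) (u : ℝ[X]) :
    (fwdOp (quadPoly 0 β γ) j u).natDegree ≤ u.natDegree := by
  have hQ : (quadPoly 0 β γ).natDegree ≤ 1 := by
    simp only [quadPoly, C_0, zero_mul, zero_add]
    exact natDegree_linear_le
  have e : fwdOp (quadPoly 0 β γ) j u =
      (taylor 1 u - u) * quadPoly 0 β γ + C (β * j) * taylor 1 u := by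
    simp only [fwdOp, taylor_quadPoly, mul_zero, zero_mul, C_0, zero_add]
    ring
  rw [e]
  refine natDegree_add_le_of_degree_le ?_ ?_
  · by_cases hu : u.natDegree = 0
    · rw [eq_C_of_natDegree_eq_zero hu]; simp
    · have : (taylor 1 u - u).natDegree ≤ u.natDegree - 1 := by
        rw [natDegree_le_iff_coeff_eq_zero]
        intro n hn
        rw [coeff_sub, coeff_taylor_of_natDegree_le _ (by omega), sub_self]
      exact natDegree_mul_le.trans (by omega)
  · exact (natDegree_C_mul_le _ _).trans (natDegree_taylor _ _).le

theorem ascQuad_succ (δ β γ : ℝ) (k : ℕ) (x : ℝ) :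
    ascQuad δ β γ (k + 1) x = ascQuad δ β γ k x * quad δ β γ (x + k) :=
  Finset.prod_range_succ _ _

theorem ascQuad_succ' (δ β γ : ℝ) (k : ℕ) (x : ℝ) :
    ascQuad δ β γ (k + 1) x = quad δ β γ x * ascQuad δ β γ k (x + 1) := by
  rw [ascQuad, Finset.prod_range_succ', mul_comm, ascQuad]
  congr 1
  · simp
  · refine Finset.prod_congr rfl fun i _ => ?_
    push_cast
    ring_nf

/-- `q^{[k]}` as a polynomial. -/
noncomputable def ascPoly (δ β γ : ℝ) (k : ℕ) : ℝ[X] :=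
  ∏ i ∈ Finset.range k, taylor (i : ℝ) (quadPoly δ β γ)

theorem eval_ascPoly (δ β γ : ℝ) (k : ℕ) (x : ℝ) :
    (ascPoly δ β γ k).eval x = ascQuad δ β γ k x := by
  simp only [ascPoly, ascQuad, eval_prod, taylor_eval, eval_quadPoly]

/-- The discrete covariance identity of first order. -/
def IsSteinFwd (μ : Measure ℕ) (m δ β γ : ℝ) : Prop :=
  ∀ h : ℕ → ℝ, Integrable (fun n : ℕ => quad δ β γ n * (h (n + 1) - h n)) μ →
    Integrable (fun n : ℕ => ((n : ℝ) - m) * h n) μ ∧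
      ∫ n, ((n : ℝ) - m) * h n ∂μ = ∫ n, quad δ β γ n * (h (n + 1) - h n) ∂μ

/-- The discrete product rule, rewritten with q(x) q^[j](x+1) = q^[j](x) q(x+j); the difference
leaves u evaluated at x + 1, hence the shift by 1. -/
theorem IsSteinFwd.isSteinChain {μ : Measure ℕ} {m δ β γ : ℝ} (hS : IsSteinFwd μ m δ β γ)
    {D : ℕ → ℕ → ℝ} (hD : ∀ j n, D (j + 1) n = D j (n + 1) - D j n) :
    IsSteinChain μ (fun n : ℕ => (n : ℝ)) 1 m (fwdOp (quadPoly δ β γ))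
      (fun j n => ascQuad δ β γ j n * D j n) := by
  intro j u h1 h2
  let h : ℕ → ℝ := fun n => u.eval (n : ℝ) * (ascQuad δ β γ j n * D j n)
  have hqh : ∀ n : ℕ, quad δ β γ n * (h (n + 1) - h n) =
      (taylor 1 u).eval (n : ℝ) * (ascQuad δ β γ (j + 1) n * D (j + 1) n) +
      (fwdOp (quadPoly δ β γ) j u).eval (n : ℝ) * (ascQuad δ β γ j n * D j n) := by
    intro n
    have e1 := ascQuad_succ δ β γ j n
    have e2 := ascQuad_succ' δ β γ j n
    simp only [h, fwdOp, eval_sub, eval_mul, taylor_eval, eval_quadPoly, hD]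
    push_cast
    have e3 : quad δ β γ n * ascQuad δ β γ j (n + 1) = ascQuad δ β γ j n * quad δ β γ (n + j) := by
      rw [← e1, ← e2]
    rw [e1]
    linear_combination (eval (n + 1 : ℝ) u * D j (n + 1)) * e3
  have hs := hS h (by simp only [hqh]; exact h2.add h1)
  simpa only [hqh] using hs

theorem fwdDiff_poly_eq {k : ℕ} {u : ℝ[X]} (hu : u.natDegree ≤ k) (x : ℝ) :
    ((fun v : ℝ[X] => taylor 1 v - v)^[k] u).eval x = k.factorial * u.coeff k := by
  have h1 : ∀ j, (fun y => ((fun v : ℝ[X] => taylor 1 v - v)^[j] u).eval y) =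
      (fwdDiff (1 : ℝ))^[j] (fun y => u.eval y) := by
    intro j
    induction j with
    | zero => rfl
    | succ j ih =>
      rw [Function.iterate_succ_apply', Function.iterate_succ_apply', ← ih]
      funext y
      simp only [fwdDiff, eval_sub, taylor_eval]
  rw [show ((fun v : ℝ[X] => taylor 1 v - v)^[k] u).eval x = _ from congrFun (h1 k) x]
  rcases hu.eq_or_lt with rfl | hlt
  · rw [Polynomial.fwdDiff_iter_degree_eq_factorial u]
    simp [mul_comm]
  · rw [Polynomial.fwdDiff_iter_eq_zero_of_degree_lt hlt, coeff_eq_zero_of_natDegree_lt hlt]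
    simp

section Law

variable {μ : Measure ℕ} {m δ β γ : ℝ}

theorem FiniteMGFNearZero.map_natCast (hμ : FiniteMGFNearZero (fun n : ℕ => (n : ℝ)) μ) :
    FiniteMGFNearZero id (μ.map fun n : ℕ => (n : ℝ)) :=
  FiniteMGFNearZero.map measurable_from_nat.aemeasurable hμ

theorem integrable_eval_natCast [IsProbabilityMeasure μ]
    (hμ : FiniteMGFNearZero (fun n : ℕ => (n : ℝ)) μ) (u : ℝ[X]) :
    Integrable (fun n : ℕ => u.eval (n : ℝ)) μ := by
  have hprob : IsProbabilityMeasure (μ.map fun n : ℕ => (n : ℝ)) :=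
    Measure.isProbabilityMeasure_map measurable_from_nat.aemeasurable
  have := (memLp_eval (zero_mem_interior_integrableExpSet hμ.map_natCast) u).integrable
    (by norm_num)
  exact (integrable_map_measure this.1 measurable_from_nat.aemeasurable).1 this

theorem IsSteinFwd.isRodriguesSystem [IsProbabilityMeasure μ] (hS : IsSteinFwd μ m δ β γ)
    (hμ : FiniteMGFNearZero (fun n : ℕ => (n : ℝ)) μ)
    (hnn : ∀ k, ∀ᵐ n : ℕ ∂μ, 0 ≤ ascQuad δ β γ k n) :
    IsRodriguesSystem (μ.map fun n : ℕ => (n : ℝ)) (adjointOp 1 m (fwdOp (quadPoly δ β γ))) δ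
      (fun k => ∫ n : ℕ, ascQuad δ β γ k n ∂μ) := by
  refine ⟨hμ.map_natCast, isRaising_fwdOp _ _ _ _, fun k => integral_nonneg_of_ae (hnn k),
    fun k u hu => ?_⟩
  have hchain := hS.isSteinChain
    (D := fun j n => ((fun v : ℝ[X] => taylor 1 v - v)^[j] u).eval (n : ℝ)) fun j n => by
      rw [Function.iterate_succ_apply', eval_sub, taylor_eval, Nat.cast_add_one]
  have h := hchain.integral_rodrigues (fun j v => by
    have := integrable_eval_natCast hμ
      (v * (ascPoly δ β γ j * (fun v : ℝ[X] => taylor 1 v - v)^[j] u))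
    simpa [eval_ascPoly] using this) k 1
  rw [integral_map measurable_from_nat.aemeasurable (by fun_prop)]
  simp only [fwdDiff_poly_eq hu, eval_one, one_mul, Function.iterate_zero, id, ascQuad,
    Finset.range_zero, Finset.prod_empty] at h ⊢
  rw [← h, integral_mul_const]
  ring

/-- Integrals of Rodrigues polynomials against a function on the natural numbers. -/
theorem IsSteinFwd.integral_rodrigues (hS : IsSteinFwd μ m δ β γ)
    (hbd : δ = 0 ∨ ∃ R : ℕ, ∀ᵐ n ∂μ, n ≤ R)
    {D : ℕ → ℕ → ℝ} (hD : ∀ j n, D (j + 1) n = D j (n + 1) - D j n)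
    (hI : ∀ j, Integrable (fun n : ℕ => ascQuad δ β γ j n * D j n) μ) (k : ℕ) :
    ∫ n : ℕ, ascQuad δ β γ k n * D k n ∂μ =
      ∫ n : ℕ, (rodrigues (adjointOp 1 m (fwdOp (quadPoly δ β γ))) k 1).eval (n : ℝ) * D 0 n ∂μ := by
  have hchain := hS.isSteinChain hD
  have hall : ∀ (j : ℕ) (u : ℝ[X]),
      Integrable (fun n : ℕ => u.eval (n : ℝ) * (ascQuad δ β γ j n * D j n)) μ := by
    intro j u
    rcases hbd with rfl | ⟨R, hR⟩
    · exact hchain.integrable (fun j u => natDegree_fwdOp_le j u) hI j u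
    · refine (hI j).bdd_mul (c := ∑ n ∈ Finset.range (R + 1), ‖u.eval (n : ℝ)‖)
        measurable_from_nat.aestronglyMeasurable ?_
      filter_upwards [hR] with n hn
      exact Finset.single_le_sum (f := fun n : ℕ => ‖u.eval (n : ℝ)‖) (fun i _ => norm_nonneg _)
        (Finset.mem_range.2 (Nat.lt_succ_of_le hn))
  have := hchain.integral_rodrigues hall k 1
  simpa [ascQuad] using this

end Law

/-! ### Ord laws: first-order identity and structure of the support -/

theorem integral_count_indicator_Ico (a b : ℕ) (g : ℕ → ℝ) :
    ∫ t, (Set.Ico a b).indicator g t ∂Measure.count = ∑ t ∈ Finset.Ico a b, g t := by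
  rw [integral_indicator measurableSet_Ico, ← Finset.coe_Ico, setIntegral_finset]
  · simp [Measure.real]
  · rw [← Set.biUnion_of_singleton (Finset.Ico a b : Set ℕ)]
    simp only [Finset.mem_coe, integrableOn_finset_iUnion]
    intro i _
    simp

theorem integral_steinKernel_mul_count (m : ℝ) (c x : ℕ) (h : ℕ → ℝ) :
    ∫ t, steinKernel (fun n : ℕ => (n : ℝ)) m c x t * (h (t + 1) - h t) ∂Measure.count =
      (x - m) * (h x - h c) := by
  have tele : ∀ a b : ℕ, a ≤ b → ∑ t ∈ Finset.Ico a b, (h (t + 1) - h t) = h b - h a := by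
    intro a b hab
    rw [Finset.sum_Ico_eq_sub _ hab, Finset.sum_range_sub, Finset.sum_range_sub]; ring
  rcases le_or_gt c x with hle | hlt
  · have e : (fun t => steinKernel (fun n : ℕ => (n : ℝ)) m c x t * (h (t + 1) - h t)) =
        (Set.Ico c x).indicator fun t => (x - m) * (h (t + 1) - h t) := by
      funext t
      by_cases h1 : c ≤ t
      · by_cases h2 : t < x <;> simp [steinKernel, h1, h2]
      · have : ¬ x ≤ t := fun h3 => h1 (hle.trans h3)
        simp [steinKernel, h1, this]
    rw [e, integral_count_indicator_Ico, ← Finset.mul_sum, tele c x hle]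
  · have e : (fun t => steinKernel (fun n : ℕ => (n : ℝ)) m c x t * (h (t + 1) - h t)) =
        (Set.Ico x c).indicator fun t => (m - x) * (h (t + 1) - h t) := by
      funext t
      by_cases h1 : c ≤ t
      · have : ¬ t < x := fun h3 => (h1.trans_lt h3).not_gt hlt
        simp [steinKernel, h1, this]
      · by_cases h2 : x ≤ t <;> simp [steinKernel, h1, h2, not_le.1 h1]
    rw [e, integral_count_indicator_Ico, ← Finset.mul_sum, tele x c hlt.le]
    ring

theorem ae_iff_forall_pos {μ : Measure ℕ} [IsFiniteMeasure μ] {p : ℕ → Prop} :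
    (∀ᵐ n ∂μ, p n) ↔ ∀ n, 0 < μ.real {n} → p n := by
  rw [ae_iff_of_countable]
  refine forall_congr' fun n => imp_congr_left ?_
  rw [measureReal_def, ENNReal.toReal_pos_iff]
  simp [pos_iff_ne_zero]

/-- A law on the natural numbers satisfying the discrete Pearson identity. -/
structure IsOrdLaw (μ : Measure ℕ) (m δ β γ : ℝ) : Prop where
  integrable : Integrable (fun n : ℕ => (n : ℝ)) μ
  mean : ∫ n : ℕ, (n : ℝ) ∂μ = m
  identity : ∀ t : ℕ, ∫ n in Set.Iic t, (m - (n : ℝ)) ∂μ = quad δ β γ t * μ.real {t}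

namespace IsOrdLaw

variable {μ : Measure ℕ} [IsProbabilityMeasure μ] {m δ β γ : ℝ}

theorem isSteinFwd (h : IsOrdLaw μ m δ β γ) : IsSteinFwd μ m δ β γ := by
  have hlaw : μ = Measure.count.withDensity fun n => ENNReal.ofReal (μ.real {n}) := by
    refine Measure.ext_of_singleton fun n => ?_
    rw [withDensity_apply _ (measurableSet_singleton n), lintegral_singleton]
    simp
  have hmeas : AEMeasurable (fun n => ENNReal.ofReal (μ.real {n})) (Measure.count : Measure ℕ) :=
    measurable_from_nat.aemeasurable
  have hfin : ∀ᵐ n ∂(Measure.count : Measure ℕ), ENNReal.ofReal (μ.real {n}) < ⊤ :=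
    ae_of_all _ fun _ => ENNReal.ofReal_lt_top
  have int_iff : ∀ g : ℕ → ℝ, Integrable g μ ↔
      Integrable (fun n => μ.real {n} * g n) Measure.count := by
    intro g
    conv_lhs => rw [hlaw]
    rw [integrable_withDensity_iff_integrable_smul₀' hmeas hfin]
    simp only [ENNReal.toReal_ofReal measureReal_nonneg, smul_eq_mul]
  have int_eq : ∀ g : ℕ → ℝ, ∫ n, g n ∂μ = ∫ n, μ.real {n} * g n ∂Measure.count := by
    intro g
    conv_lhs => rw [hlaw]
    rw [integral_withDensity_eq_integral_toReal_smul₀ hmeas hfin]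
    simp only [ENNReal.toReal_ofReal measureReal_nonneg, smul_eq_mul]
  intro g hI
  have hcomm : ∀ n : ℕ, μ.real {n} * (quad δ β γ n * (g (n + 1) - g n)) =
      quad δ β γ n * μ.real {n} * (g (n + 1) - g n) := fun n => by ring
  rw [int_iff] at hI
  simp only [hcomm] at hI
  have hm0 : 0 ≤ m := h.mean ▸ integral_nonneg fun n => Nat.cast_nonneg n
  have hst := stein_identity (μ := μ) (ν := Measure.count) measurable_from_nat h.integrable h.mean
    -- The mean need not be an integer; its floor still separates the integers at most m from those
    -- at least m.
    (c := ⌊m⌋₊) (fun x hx => (Nat.lt_of_floor_lt hx).le)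
    (fun x hx => (Nat.cast_le.2 hx.le).trans (Nat.floor_le hm0))
    (ψ := fun n => g (n + 1) - g n) (h := g) h.identity
    measurable_from_nat.aestronglyMeasurable hI
    (ae_of_all _ fun x => integral_steinKernel_mul_count m _ x g)
  refine ⟨hst.1, hst.2.trans ?_⟩
  rw [int_eq]
  simp only [hcomm]

/-- q(z)p(z) is both E[(m-X)1_{X≤z}] and E[(X-m)1_{X>z}]. For z < m the atom at x bounds the first
below, otherwise the atom at y bounds the second. Hence the support has no gaps. -/
theorem pos_of_mem_Ico (h : IsOrdLaw μ m δ β γ) {x y z : ℕ} (hx : 0 < μ.real {x})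
    (hy : 0 < μ.real {y}) (hxz : x ≤ z) (hzy : z < y) : 0 < quad δ β γ z ∧ 0 < μ.real {z} := by
  have hpos : 0 < quad δ β γ z * μ.real {z} := by
    rw [← h.identity]
    rcases lt_or_ge (z : ℝ) m with hz | hz
    · have h1 : ∫ n in {x}, (m - (n : ℝ)) ∂μ ≤ ∫ n in Set.Iic z, (m - (n : ℝ)) ∂μ := by
        refine setIntegral_mono_set ((integrable_const m).sub h.integrable).integrableOn ?_
          (Set.singleton_subset_iff.2 (Set.mem_Iic.2 hxz)).eventuallyLE
        refine (ae_restrict_iff' measurableSet_Iic).2 (ae_of_all _ fun n hn => ?_)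
        have : (n : ℝ) ≤ z := Nat.cast_le.2 hn
        exact sub_nonneg.2 (by linarith)
      rw [integral_singleton, smul_eq_mul] at h1
      have : (x : ℝ) ≤ z := Nat.cast_le.2 hxz
      exact (mul_pos hx (by linarith)).trans_le h1
    · rw [← setIntegral_Ioi_sub_eq h.integrable h.mean]
      have h1 : ∫ n in {y}, ((n : ℝ) - m) ∂μ ≤ ∫ n in Set.Ioi z, ((n : ℝ) - m) ∂μ := by
        refine setIntegral_mono_set (h.integrable.sub (integrable_const m)).integrableOn ?_
          (Set.singleton_subset_iff.2 (Set.mem_Ioi.2 hzy)).eventuallyLE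
        refine (ae_restrict_iff' measurableSet_Ioi).2 (ae_of_all _ fun n hn => ?_)
        have : (z : ℝ) < n := Nat.cast_lt.2 hn
        exact sub_nonneg.2 (by linarith)
      rw [integral_singleton, smul_eq_mul] at h1
      have : (z : ℝ) < y := Nat.cast_lt.2 hzy
      exact (mul_pos hy (by linarith)).trans_le h1
  have hq := pos_of_mul_pos_left hpos measureReal_nonneg
  exact ⟨hq, pos_of_mul_pos_right hpos hq.le⟩

/-- With no mass at y + 1, the truncated mean is the same at y and y + 1, and the identity at y + 1
makes it zero. -/
theorem quad_eq_zero (h : IsOrdLaw μ m δ β γ) {y : ℕ} (hy : 0 < μ.real {y})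
    (hy' : μ.real {y + 1} = 0) : quad δ β γ y = 0 := by
  have h1 := h.identity y
  have h2 := h.identity (y + 1)
  have hset : Set.Iic (y + 1) = Set.Iic y ∪ {y + 1} := by
    ext n; simp only [Set.mem_Iic, Set.mem_union, Set.mem_singleton_iff]; omega
  have hi : Integrable (fun n : ℕ => m - (n : ℝ)) μ := (integrable_const m).sub h.integrable
  rw [hset, setIntegral_union (by simp) (measurableSet_singleton _) hi.integrableOn
    hi.integrableOn, integral_singleton, hy', h1] at h2
  simpa [hy.ne'] using h2

/-- Walking right from an atom, q stays positive until the last atom, where it is zero. Later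
factors of either sign then do no harm. -/
theorem ascQuad_eq_zero_or_pos (h : IsOrdLaw μ m δ β γ) {x : ℕ} (hx : 0 < μ.real {x}) (k : ℕ) :
    ascQuad δ β γ k x = 0 ∨ (0 < ascQuad δ β γ k x ∧ 0 < μ.real {x + k}) := by
  induction k with
  | zero => right; simpa [ascQuad] using hx
  | succ k ih =>
    rw [ascQuad_succ]
    rcases ih with h0 | ⟨h1, h2⟩
    · left; rw [h0, zero_mul]
    · rcases (measureReal_nonneg (μ := μ) (s := {x + k + 1})).eq_or_lt with h3 | h3
      · left
        have := h.quad_eq_zero h2 h3.symm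
        push_cast at this
        rw [this, mul_zero]
      · right
        have := (h.pos_of_mem_Ico h2 h3 le_rfl (Nat.lt_succ_self _)).1
        push_cast at this
        exact ⟨mul_pos h1 this, h3⟩

theorem ascQuad_nonneg (h : IsOrdLaw μ m δ β γ) (k : ℕ) : ∀ᵐ n : ℕ ∂μ, 0 ≤ ascQuad δ β γ k n :=
  ae_iff_forall_pos.2 fun _ hn => (h.ascQuad_eq_zero_or_pos hn k).elim (fun h0 => h0.ge)
    fun h1 => h1.1.le

/-- q^[k] must vanish at the leftmost atom r, whereas an atom at r + k or beyond would make all k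
factors positive there. -/
theorem exists_support_of_integral_eq_zero (h : IsOrdLaw μ m δ β γ)
    (hμ : FiniteMGFNearZero (fun n : ℕ => (n : ℝ)) μ) {k : ℕ}
    (hk : ∫ n : ℕ, ascQuad δ β γ k n ∂μ = 0) : ∃ r, ∀ᵐ n ∂μ, r ≤ n ∧ n < r + k := by
  have hex : ∃ r, 0 < μ.real {r} := by
    by_contra! hcon
    have : ∀ᵐ n ∂μ, False := ae_iff_forall_pos.2 fun n hn => (hcon n).not_gt hn
    simpa using this.exists
  classical
  refine ⟨Nat.find hex, ae_iff_forall_pos.2 fun n hn => ⟨Nat.find_min' hex hn, ?_⟩⟩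
  by_contra! hle
  have hr := Nat.find_spec hex
  have hi : Integrable (fun n : ℕ => ascQuad δ β γ k n) μ := by
    simpa only [eval_ascPoly] using integrable_eval_natCast hμ (ascPoly δ β γ k)
  have h0 := (integral_eq_zero_iff_of_nonneg_ae (h.ascQuad_nonneg k) hi).1 hk
  have h1 : ascQuad δ β γ k (Nat.find hex) = 0 := ae_iff_forall_pos.1 h0 _ hr
  refine (Finset.prod_pos fun i hi => ?_).ne' h1
  have := (h.pos_of_mem_Ico hr hn (Nat.le_add_right _ i)
    (lt_of_lt_of_le (Nat.add_lt_add_left (Finset.mem_range.1 hi) _) hle)).1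
  push_cast at this
  exact this

theorem exists_monic (h : IsOrdLaw μ m δ β γ)
    (hμ : FiniteMGFNearZero (fun n : ℕ => (n : ℝ)) μ) {k : ℕ}
    (hk : ∫ n : ℕ, ascQuad δ β γ k n ∂μ = 0) :
    ∃ M : ℝ[X], M.Monic ∧ M.natDegree = k ∧
      ∀ᵐ x ∂(μ.map fun n : ℕ => (n : ℝ)), M.eval x = 0 := by
  obtain ⟨r, hr⟩ := h.exists_support_of_integral_eq_zero hμ hk
  refine ⟨∏ i ∈ Finset.range k, (X - C ((r + i : ℕ) : ℝ)),
    monic_prod_of_monic _ _ fun i _ => monic_X_sub_C _, ?_, ?_⟩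
  · rw [natDegree_prod_of_monic _ _ fun i _ => monic_X_sub_C _]
    simp only [natDegree_X_sub_C, Finset.sum_const, Finset.card_range, smul_eq_mul, mul_one]
  · rw [ae_map_iff measurable_from_nat.aemeasurable
      (measurableSet_eq_fun (Polynomial.continuous _).measurable measurable_const)]
    filter_upwards [hr] with n hn
    rw [eval_prod]
    refine Finset.prod_eq_zero (Finset.mem_range.2 (by omega : n - r < k)) ?_
    rw [Nat.add_sub_cancel' hn.1]
    simp

/-- For δ < 0, q ≥ 0 on the support bounds it. For δ > 0, `delta_nonpos` forces some E[q^[k]] = 0,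
hence finite support. -/
theorem delta_eq_zero_or_bounded (h : IsOrdLaw μ m δ β γ)
    (hμ : FiniteMGFNearZero (fun n : ℕ => (n : ℝ)) μ) : δ = 0 ∨ ∃ R : ℕ, ∀ᵐ n ∂μ, n ≤ R := by
  rcases lt_trichotomy δ 0 with hδ | hδ | hδ
  · right
    obtain ⟨R, hR⟩ := bounded_of_quad_nonneg (β := β) (γ := γ) hδ
    refine ⟨⌈R⌉₊, ?_⟩
    filter_upwards [h.ascQuad_nonneg 1] with n hn
    have h1 := hR n (by simpa [ascQuad, eval_quadPoly] using hn)
    exact Nat.cast_le.1 (((le_abs_self _).trans h1).trans (Nat.le_ceil R))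
  · exact Or.inl hδ
  · right
    have hprob : IsProbabilityMeasure (μ.map fun n : ℕ => (n : ℝ)) :=
      Measure.isProbabilityMeasure_map measurable_from_nat.aemeasurable
    have hsys := h.isSteinFwd.isRodriguesSystem hμ h.ascQuad_nonneg
    have hex : ∃ k, ∫ n : ℕ, ascQuad δ β γ k n ∂μ = 0 := by
      by_contra! hcon
      exact hδ.not_ge (hsys.delta_nonpos fun k => (hsys.nonneg k).lt_of_ne' (hcon k))
    obtain ⟨k, hk⟩ := hex
    obtain ⟨r, hr⟩ := h.exists_support_of_integral_eq_zero hμ hk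
    exact ⟨r + k, hr.mono fun n hn => hn.2.le⟩

theorem hasSum_cov (h : IsOrdLaw μ m δ β γ)
    (hμ : FiniteMGFNearZero (fun n : ℕ => (n : ℝ)) μ) {g₁ g₂ : ℕ → ℝ} (hL₁ : MemLp g₁ 2 μ)
    (hL₂ : MemLp g₂ 2 μ)
    (hI₁ : ∀ k : ℕ, Integrable (fun n : ℕ => ascQuad δ β γ k n * (fwdDiff 1)^[k] g₁ n) μ)
    (hI₂ : ∀ k : ℕ, Integrable (fun n : ℕ => ascQuad δ β γ k n * (fwdDiff 1)^[k] g₂ n) μ) :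
    HasSum (fun i : ℕ => ((∫ n : ℕ, ascQuad δ β γ (i + 1) n * (fwdDiff 1)^[i + 1] g₁ n ∂μ) *
        (∫ n : ℕ, ascQuad δ β γ (i + 1) n * (fwdDiff 1)^[i + 1] g₂ n ∂μ)) /
        (((i + 1).factorial : ℝ) * (∫ n : ℕ, ascQuad δ β γ (i + 1) n ∂μ) *
          ∏ j ∈ Finset.Icc i (2 * i), (1 - (j : ℝ) * δ)))
      (covariance g₁ g₂ μ) := by
  have hprob : IsProbabilityMeasure (μ.map fun n : ℕ => (n : ℝ)) :=
    Measure.isProbabilityMeasure_map measurable_from_nat.aemeasurable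
  have hsys := h.isSteinFwd.isRodriguesSystem hμ h.ascQuad_nonneg
  have hcast : AEMeasurable (fun n : ℕ => (n : ℝ)) μ := measurable_from_nat.aemeasurable
  -- The floor extends g to the line, where the Rodrigues system lives.
  have hmeas : ∀ g : ℕ → ℝ, Measurable fun x : ℝ => g ⌊x⌋₊ := fun g =>
    measurable_from_nat.comp Nat.measurable_floor
  have hL : ∀ {g : ℕ → ℝ}, MemLp g 2 μ →
      MemLp (fun x : ℝ => g ⌊x⌋₊) 2 (μ.map fun n : ℕ => (n : ℝ)) := by
    intro g hg
    rw [memLp_map_measure_iff (hmeas g).aestronglyMeasurable hcast]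
    simpa [Function.comp_def] using hg
  have hsum := hsys.hasSum_cov (fun k hk => h.exists_monic hμ hk) (hL hL₁) (hL hL₂)
  have hInt : ∀ {g : ℕ → ℝ},
      (∀ k : ℕ, Integrable (fun n : ℕ => ascQuad δ β γ k n * (fwdDiff 1)^[k] g n) μ) →
      ∀ k, ∫ x, (rodrigues (adjointOp 1 m (fwdOp (quadPoly δ β γ))) k 1).eval x * g ⌊x⌋₊
        ∂(μ.map fun n : ℕ => (n : ℝ)) = ∫ n : ℕ, ascQuad δ β γ k n * (fwdDiff 1)^[k] g n ∂μ := by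
    intro g hg k
    rw [h.isSteinFwd.integral_rodrigues (h.delta_eq_zero_or_bounded hμ)
      (D := fun j => (fwdDiff 1)^[j] g)
      (fun j n => by rw [Function.iterate_succ_apply']; rfl) hg k, integral_map hcast]
    · simp
    · exact ((Polynomial.continuous _).measurable.mul (hmeas g)).aestronglyMeasurable
  simp only [hInt hI₁, hInt hI₂, lead_succ] at hsum
  rw [covariance_map (hL hL₁).1 (hL hL₂).1 hcast] at hsum
  simpa [Function.comp_def] using hsum

end IsOrdLaw

theorem IsDiscrete.isOrdLaw {Ω : Type*} [MeasurableSpace Ω] {P : Measure Ω}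
    [IsProbabilityMeasure P] {X : Ω → ℕ} {δ β γ : ℝ} (h : IsDiscrete P X δ β γ) :
    IsOrdLaw (P.map X) (∫ ω, (X ω : ℝ) ∂P) δ β γ := by
  have hX := h.aemeasurable
  have hreal : ∀ n : ℕ, (P.map X).real {n} = P.real {ω | X ω = n} := by
    intro n
    rw [map_measureReal_apply_of_aemeasurable hX (measurableSet_singleton n)]
    rfl
  have hInt : Integrable (fun n : ℕ => (n : ℝ)) (P.map X) :=
    (integrable_map_measure measurable_from_nat.aestronglyMeasurable hX).2 h.integrable
  have hprob : IsProbabilityMeasure (P.map X) := Measure.isProbabilityMeasure_map hX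
  have hi : Integrable (fun n : ℕ => (∫ ω, (X ω : ℝ) ∂P) - (n : ℝ)) (P.map X) :=
    (integrable_const _).sub hInt
  refine ⟨hInt, integral_map hX measurable_from_nat.aestronglyMeasurable, fun t => ?_⟩
  rw [hreal, ← h.identity t, show Set.Iic t = ↑(Finset.range (t + 1)) by
    ext; simp, setIntegral_finset _ hi.integrableOn]
  simp only [hreal, smul_eq_mul, mul_comm]

theorem IsDiscrete.hasSum_covariance {Ω : Type*} [MeasurableSpace Ω] {P : Measure Ω}
    [IsProbabilityMeasure P] {X : Ω → ℕ} {δ β γ : ℝ} (h : IsDiscrete P X δ β γ)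
    (hmgf : FiniteMGFNearZero (fun ω => (X ω : ℝ)) P) {g₁ g₂ : ℕ → ℝ}
    (hL₁ : MemLp g₁ 2 (P.map X)) (hL₂ : MemLp g₂ 2 (P.map X))
    (hI₁ : ∀ k : ℕ, Integrable (fun ω => ascQuad δ β γ k (X ω) * |(fwdDiff 1)^[k] g₁ (X ω)|) P)
    (hI₂ : ∀ k : ℕ, Integrable (fun ω => ascQuad δ β γ k (X ω) * |(fwdDiff 1)^[k] g₂ (X ω)|) P) :
    HasSum (fun i : ℕ => ((∫ ω, ascQuad δ β γ (i + 1) (X ω) * (fwdDiff 1)^[i + 1] g₁ (X ω) ∂P) *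
        (∫ ω, ascQuad δ β γ (i + 1) (X ω) * (fwdDiff 1)^[i + 1] g₂ (X ω) ∂P)) /
        (((i + 1).factorial : ℝ) * (∫ ω, ascQuad δ β γ (i + 1) (X ω) ∂P) *
          ∏ j ∈ Finset.Icc i (2 * i), (1 - (j : ℝ) * δ)))
      (covariance (fun ω => g₁ (X ω)) (fun ω => g₂ (X ω)) P) := by
  have hX := h.aemeasurable
  have hprob : IsProbabilityMeasure (P.map X) := Measure.isProbabilityMeasure_map hX
  have hsm : ∀ g : ℕ → ℝ, AEStronglyMeasurable g (P.map X) := fun g =>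
    measurable_from_nat.aestronglyMeasurable
  have hμ : FiniteMGFNearZero (fun n : ℕ => (n : ℝ)) (P.map X) := by
    obtain ⟨t, ht, hI⟩ := hmgf
    exact ⟨t, ht, fun s hs => (integrable_map_measure (hsm _) hX).2 (hI s hs)⟩
  have hInt : ∀ {g : ℕ → ℝ},
      (∀ k : ℕ, Integrable (fun ω => ascQuad δ β γ k (X ω) * |(fwdDiff 1)^[k] g (X ω)|) P) →
      ∀ k, Integrable (fun n : ℕ => ascQuad δ β γ k n * (fwdDiff 1)^[k] g n) (P.map X) := by
    intro g hg k
    rw [integrable_map_measure (hsm _) hX]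
    refine (hg k).mono ((hsm _).comp_aemeasurable hX) (ae_of_all _ fun ω => ?_)
    simp
  have hsum := h.isOrdLaw.hasSum_cov hμ hL₁ hL₂ (hInt hI₁) (hInt hI₂)
  simp only [integral_map hX (hsm _)] at hsum
  rw [covariance_map hL₁.1 hL₂.1 hX] at hsum
  exact hsum

end Pearson

theorem theorem5p2 {Ω : Type*} [MeasurableSpace Ω] (P : Measure Ω) [IsProbabilityMeasure P] :
    (∀ (X : Ω → ℝ) (f : ℝ → ℝ) (δ β γ : ℝ), Pearson.IsContinuous P X f δ β γ →
      Pearson.FiniteMGFNearZero X P →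
      ∀ g₁ g₂ : ℝ → ℝ,
        MemLp g₁ 2 (P.map X) → MemLp g₂ 2 (P.map X) →
        ContDiffOn ℝ ((⊤ : ℕ∞) : WithTop ℕ∞) g₁ (Pearson.openSupport f) →
        ContDiffOn ℝ ((⊤ : ℕ∞) : WithTop ℕ∞) g₂ (Pearson.openSupport f) →
        (∀ k : ℕ, Integrable
          (fun ω => Pearson.quad δ β γ (X ω) ^ k * |iteratedDeriv k g₁ (X ω)|) P) →
        (∀ k : ℕ, Integrable
          (fun ω => Pearson.quad δ β γ (X ω) ^ k * |iteratedDeriv k g₂ (X ω)|) P) →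
        HasSum
          (fun n : ℕ =>
            let k := n + 1
            ((∫ ω, Pearson.quad δ β γ (X ω) ^ k * iteratedDeriv k g₁ (X ω) ∂P) *
              (∫ ω, Pearson.quad δ β γ (X ω) ^ k * iteratedDeriv k g₂ (X ω) ∂P)) /
            ((k.factorial : ℝ) * (∫ ω, Pearson.quad δ β γ (X ω) ^ k ∂P) *
              ∏ j ∈ Finset.Icc (k - 1) (2 * k - 2), (1 - (j : ℝ) * δ)))
          (covariance (fun ω => g₁ (X ω)) (fun ω => g₂ (X ω)) P)) ∧
    (∀ (X : Ω → ℕ) (δ β γ : ℝ), Pearson.IsDiscrete P X δ β γ →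
      Pearson.FiniteMGFNearZero (fun ω => (X ω : ℝ)) P →
      ∀ g₁ g₂ : ℕ → ℝ,
        MemLp g₁ 2 (P.map X) → MemLp g₂ 2 (P.map X) →
        (∀ k : ℕ, Integrable
          (fun ω => Pearson.ascQuad δ β γ k (X ω) * |(fwdDiff 1)^[k] g₁ (X ω)|) P) →
        (∀ k : ℕ, Integrable
          (fun ω => Pearson.ascQuad δ β γ k (X ω) * |(fwdDiff 1)^[k] g₂ (X ω)|) P) →
        HasSum
          (fun n : ℕ =>
            let k := n + 1
            if (∫ ω, Pearson.ascQuad δ β γ k (X ω) ∂P) = 0 then 0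
            else
              ((∫ ω, Pearson.ascQuad δ β γ k (X ω) * (fwdDiff 1)^[k] g₁ (X ω) ∂P) *
                (∫ ω, Pearson.ascQuad δ β γ k (X ω) * (fwdDiff 1)^[k] g₂ (X ω) ∂P)) /
              ((k.factorial : ℝ) * (∫ ω, Pearson.ascQuad δ β γ k (X ω) ∂P) *
                ∏ j ∈ Finset.Icc (k - 1) (2 * k - 2), (1 - (j : ℝ) * δ)))
          (covariance (fun ω => g₁ (X ω)) (fun ω => g₂ (X ω)) P)) := by
  refine ⟨fun X f δ β γ h hmgf g₁ g₂ hL₁ hL₂ hs₁ hs₂ hI₁ hI₂ => ?_,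
    fun X δ β γ h hmgf g₁ g₂ hL₁ hL₂ hI₁ hI₂ => ?_⟩
  · exact h.hasSum_covariance hmgf hL₁ hL₂ hs₁ hs₂ hI₁ hI₂
  · convert h.hasSum_covariance hmgf hL₁ hL₂ hI₁ hI₂ using 2 with i
    simp only [Nat.add_sub_cancel, show 2 * (i + 1) - 2 = 2 * i by omega]
    -- Division by zero already gives the value prescribed for the degenerate terms.
    split_ifs with h0
    · rw [h0]; simp
    · rfl
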